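/- Let $r \ge 3$ be a fixed integer. An instance of \textsc{$r$-Dense Feedback Arc Set} ($r$-FAST) consists of a finite vertex set $V$, a selected vertex $\mathrm{sel}(S) \in S$ for every set $S \subseteq V$ with $|S| = r$ (such sets $S$ are the constraints), and a parameter $k \in \mathbb{N} = \{0, 1, 2, \dots\}$. A ranking (linear order) $\sigma$ of $V$ satisfies the constraint $S$ if $u <_\sigma \mathrm{sel}(S)$ for every $u \in S \setminus \{\mathrm{sel}(S)\}$. The instance is a \textsc{Yes}-instance if some ranking of $V$ satisfies all but at most $k$ of the constraints. Theorem. For every fixed $r \ge 3$, $r$-FAST admits a kernel with at most $6k + r$ vertices. That is, there is an algorithm, running in time polynomial in the size of its input, that transforms every instance $(V, \mathrm{sel}, k)$ of $r$-FAST into an instance $(V', \mathrm{sel}', k')$ of $r$-FAST such that (i) $(V', \mathrm{sel}', k')$ is a \textsc{Yes}-instance if and only if $(V, \mathrm{sel}, k)$ is a \textsc{Yes}-instance; (ii) $k' \le k$; (iii) $|V'| \le 6k + r$ if $k \ge 1$, and $|V'| \le r + 1$ if $k = 0$. -/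

import Mathlib

/-! ## The problem: dense feedback arc set with constraints of arity `r` -/

namespace DenseFAS

/-- The constraints of a dense instance on the vertex set `Fin n`: all `r`-element subsets. -/
abbrev Constraint (r n : ℕ) : Type := {S : Finset (Fin n) // S.card = r}

/-- A ranking of the vertices; `σ v` is the position of `v`, and `u <_σ v` is `σ u < σ v`. -/
abbrev Ranking (n : ℕ) : Type := Equiv.Perm (Fin n)

/-- An instance: `n` vertices (named `0, …, n - 1`), one selected vertex in every `r`-element set
of vertices, and the parameter `k`. -/
structure Instance (r : ℕ) where
  n : ℕ
  sel : Constraint r n → Fin n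
  sel_mem : ∀ S, sel S ∈ S.1
  k : ℕ

variable {r : ℕ}

/-- The constraint system: `0` if the constraint `S` is satisfied by the ranking, that is, if every
other vertex of `S` is ranked before the selected one, and `1` if it is not. -/
def Instance.c (R : Instance r) (σ : Ranking R.n) (S : Constraint r R.n) : ℕ :=
  if ∀ u ∈ S.1, u ≠ R.sel S → σ u < σ (R.sel S) then 0 else 1

/-- The number of constraints that are not satisfied by a ranking. -/
def Instance.cost (R : Instance r) (σ : Ranking R.n) : ℕ :=
  ∑ S : Constraint r R.n, R.c σ S

/-- Some ranking satisfies all but at most `k` constraints. -/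
def Instance.IsYes (R : Instance r) : Prop :=
  ∃ σ : Ranking R.n, R.cost σ ≤ R.k

/-- The selected vertex of a set of `r` vertices, as a number. (The value `0` on sets of another
size is never used.) -/
def Instance.selVal (R : Instance r) (S : Finset (Fin R.n)) : ℕ :=
  if h : S.card = r then (R.sel ⟨S, h⟩ : ℕ) else 0

/-- An instance written as a list of numbers: the number of vertices, the parameter, and then, for
every set of `r` vertices, its elements in increasing order followed by its selected vertex. -/
def Instance.encode (R : Instance r) : List ℕ :=
  R.n :: R.k :: ((List.finRange R.n).sublistsLen r).flatMap
    fun l => l.map Fin.val ++ [R.selVal l.toFinset]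

end DenseFAS

/-! ## Polynomial time: structured programs on a random access machine

A machine has natural-number registers `x₀, x₁, …` and arrays `A₀, A₁, …` of natural numbers, of
which a program mentions finitely many. The arithmetic operations are addition and truncated
subtraction only (no multiplication), so that the unit-cost measure is polynomially related to
Turing machine time. -/

namespace RAM

/-- The contents of the registers and of the arrays. -/
structure Store where
  var : ℕ → ℕ
  arr : ℕ → ℕ → ℕ

/-- Expressions: constants, registers, array entries `A_a[i]`, sums and truncated differences. -/
inductive Expr : Type
  | lit (m : ℕ)
  | var (x : ℕ)
  | get (a : ℕ) (i : Expr)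
  | add (e₁ e₂ : Expr)
  | sub (e₁ e₂ : Expr)

/-- The value of an expression. -/
def Expr.eval (s : Store) : Expr → ℕ
  | .lit m => m
  | .var x => s.var x
  | .get a i => s.arr a (i.eval s)
  | .add e₁ e₂ => e₁.eval s + e₂.eval s
  | .sub e₁ e₂ => e₁.eval s - e₂.eval s

/-- Programs. A test `e` succeeds if the value of `e` is not `0`. -/
inductive Prog : Type
  | skip
  | assign (x : ℕ) (e : Expr)
  | write (a : ℕ) (i e : Expr)
  | seq (p q : Prog)
  | cond (e : Expr) (p q : Prog)
  | loop (e : Expr) (p : Prog)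

/-- `Runs p s s' t`: started in the store `s`, the program `p` halts in the store `s'` after `t`
steps, where each assignment, array write and test counts as one step. -/
inductive Runs : Prog → Store → Store → ℕ → Prop
  | skip (s : Store) : Runs .skip s s 1
  | assign (s : Store) (x : ℕ) (e : Expr) :
      Runs (.assign x e) s { s with var := Function.update s.var x (e.eval s) } 1
  | write (s : Store) (a : ℕ) (i e : Expr) :
      Runs (.write a i e) s
        { s with arr := Function.update s.arr a
                  (Function.update (s.arr a) (i.eval s) (e.eval s)) } 1
  | seq {p q : Prog} {s s' s'' : Store} {t t' : ℕ} :
      Runs p s s' t → Runs q s' s'' t' → Runs (.seq p q) s s'' (t + t')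
  | cond_true {e : Expr} {p q : Prog} {s s' : Store} {t : ℕ} :
      e.eval s ≠ 0 → Runs p s s' t → Runs (.cond e p q) s s' (t + 1)
  | cond_false {e : Expr} {p q : Prog} {s s' : Store} {t : ℕ} :
      e.eval s = 0 → Runs q s s' t → Runs (.cond e p q) s s' (t + 1)
  | loop_done {e : Expr} {p : Prog} {s : Store} :
      e.eval s = 0 → Runs (.loop e p) s s 1
  | loop_step {e : Expr} {p : Prog} {s s' s'' : Store} {t t' : ℕ} :
      e.eval s ≠ 0 → Runs p s s' t → Runs (.loop e p) s' s'' t' →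
        Runs (.loop e p) s s'' (t + t' + 1)

/-- The initial store: the input is in the array `A₀`, its number of entries is in the register
`x₀`, and everything else is `0`. -/
def Store.input (l : List ℕ) : Store where
  var x := if x = 0 then l.length else 0
  arr a i := if a = 0 then l.getD i 0 else 0

/-- The output of a store: the first `x₀` entries of the array `A₀`. -/
def Store.output (s : Store) : List ℕ :=
  (List.range (s.var 0)).map (s.arr 0)

/-- The length of an input: its numbers are counted in binary, with one separator each. -/
def bitLength (l : List ℕ) : ℕ :=
  (l.map fun m => Nat.size m + 1).sum

/-- A function is computable in polynomial time with respect to encodings of its arguments and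
its values: one program computes it on all inputs, in a number of steps that is polynomial in the
length of the input. -/
def PolyTimeComputable {α β : Type} (encα : α → List ℕ) (encβ : β → List ℕ) (f : α → β) : Prop :=
  ∃ (p : Prog) (P : Polynomial ℕ), ∀ x : α, ∃ (s : Store) (t : ℕ),
    Runs p (Store.input (encα x)) s t ∧ t ≤ P.eval (bitLength (encα x)) ∧ s.output = encβ (f x)

end RAM

namespace DenseFAS

/-- The problem with constraints of arity `r` admits a kernel with at most `g k` vertices: some
polynomial-time algorithm turns every instance with parameter `k` into an equivalent instance with
at most `g k` vertices and a parameter that is at most `k`. -/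
def AdmitsVertexKernel (r : ℕ) (g : ℕ → ℕ) : Prop :=
  ∃ f : Instance r → Instance r,
    RAM.PolyTimeComputable Instance.encode Instance.encode f ∧
      ∀ R : Instance r,
        ((f R).IsYes ↔ R.IsYes) ∧ (f R).n ≤ g R.k ∧ (f R).k ≤ R.k

end DenseFAS

/-! ### Peeling off the last vertex -/

namespace DenseFAS

/-! Call a constraint containing `v` won by `v` if `v` is selected in it, and lost otherwise. The
last vertex of a ranking violates exactly the constraints it loses. Any two vertices lie together in
`(|W| - 2).choose (r - 2)` constraints, each lost by at least one of them. For `r ≥ 3` this number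
is at least `|W| - r + 1`, which exceeds `2k` once `|W| ≥ 2k + r`. Hence at most one vertex loses at
most `k` constraints, and if the cost can be at most `k`, it is a vertex with the most wins. That
vertex must then be last in every ranking of cost at most `k`, so it can be removed while the budget
is lowered by its number of losses (`yesOn_iff_erase`).

Repeating this leaves a set `W` of at most `2k + r - 1` vertices. If `w` is the total number of wins
of removed vertices, counted at their removal, the losses paid for are `dead - w`, where `dead`
counts the constraints not inside `W` (`Peeled.step`). If this exceeds `k`, the answer is a fixed
No-instance on `r + 1` vertices; otherwise it is the restriction to `W` with parameter `k + w - dead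
≤ k`. The resulting bound, the maximum of `r + 1` and `2k + r - 1`, is stronger than the one
required.

The rest is effectivity. The input lists all `r`-sets in a fixed order, so wins, dead sets and the
renamed restriction come from scans of that list. A small logic of total correctness with time
bounds (`Exec`) verifies the program. The number of vertices is polynomial in the input length
because there are at least `n - r + 1` constraints when `n ≥ r`. -/

/-- The `r`-subsets of `W` that the ranking `g` violates, where `s` selects a vertex in each set. -/
def violated (r : ℕ) (s : Finset ℕ → ℕ) (g : ℕ → ℕ) (W : Finset ℕ) : Finset (Finset ℕ) :=
  (W.powersetCard r).filter fun S => ¬ ∀ u ∈ S, u ≠ s S → g u < g (s S)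

/-- The number of `r`-subsets of `W` in which `v` is selected. -/
def wins (r : ℕ) (s : Finset ℕ → ℕ) (W : Finset ℕ) (v : ℕ) : ℕ :=
  ((W.powersetCard r).filter fun S => s S = v).card

/-- The number of `r`-subsets of `V` that are not contained in `W`. -/
def dead (r : ℕ) (V W : Finset ℕ) : ℕ :=
  ((V.powersetCard r).filter fun S => ¬ S ⊆ W).card

/-- The `r`-subsets of `W` that contain `v` without selecting it. -/
def lost (r : ℕ) (s : Finset ℕ → ℕ) (W : Finset ℕ) (v : ℕ) : Finset (Finset ℕ) :=
  (W.powersetCard r).filter fun S => v ∈ S ∧ s S ≠ v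

/-- Some ranking of `W` violates at most `m` constraints. -/
def YesOn (r : ℕ) (s : Finset ℕ → ℕ) (W : Finset ℕ) (m : ℕ) : Prop :=
  ∃ g : ℕ → ℕ, Set.InjOn g W ∧ (violated r s g W).card ≤ m

/-- Induction by Pascal's rule. It is needed twice: to make the common constraints of two vertices
outnumber `2k`, and to bound the number of vertices by the number of constraints. -/
theorem sub_add_one_le_choose {m t : ℕ} (ht : 1 ≤ t) (h : t ≤ m) : m - t + 1 ≤ m.choose t := by
  induction m generalizing t with
  | zero => omega
  | succ m ih =>
    obtain ⟨t, rfl⟩ : ∃ u, t = u + 1 := ⟨t - 1, by omega⟩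
    rw [Nat.choose_succ_succ']
    rcases Nat.lt_or_ge m (t + 1) with h' | h'
    · have := Nat.choose_pos (show t ≤ m by omega)
      omega
    · have h1 := ih (t := t + 1) (by omega) h'
      have h2 := Nat.choose_pos (show t ≤ m by omega)
      omega

theorem card_filter_superset {W A : Finset ℕ} {r : ℕ} (hA : A ⊆ W) (hr : A.card ≤ r) :
    ((W.powersetCard r).filter fun S => A ⊆ S).card = (W.card - A.card).choose (r - A.card) := by
  rw [← Finset.card_sdiff_of_subset hA, ← Finset.card_powersetCard]
  refine Finset.card_bij' (fun S _ => S \ A) (fun S _ => S ∪ A) ?_ ?_ ?_ ?_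
  · intro S hS
    simp only [Finset.mem_filter, Finset.mem_powersetCard] at hS ⊢
    exact ⟨Finset.sdiff_subset_sdiff hS.1.1 le_rfl, by rw [Finset.card_sdiff_of_subset hS.2, hS.1.2]⟩
  · intro S hS
    simp only [Finset.mem_filter, Finset.mem_powersetCard] at hS ⊢
    have hd : Disjoint S A := Finset.disjoint_of_subset_left hS.1 Finset.sdiff_disjoint
    refine ⟨⟨Finset.union_subset (hS.1.trans Finset.sdiff_subset) hA, ?_⟩, Finset.subset_union_right⟩
    rw [Finset.card_union_of_disjoint hd, hS.2]
    omega
  · intro S hS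
    exact Finset.sdiff_union_of_subset (Finset.mem_filter.1 hS).2
  · intro S hS
    have hd : Disjoint S A :=
      Finset.disjoint_of_subset_left (Finset.mem_powersetCard.1 hS).1 Finset.sdiff_disjoint
    rw [Finset.union_sdiff_right, Finset.sdiff_eq_self_of_disjoint hd]

theorem card_filter_mem {W : Finset ℕ} {r v : ℕ} (hv : v ∈ W) (hr : 1 ≤ r) :
    ((W.powersetCard r).filter fun S => v ∈ S).card = (W.card - 1).choose (r - 1) := by
  simpa using card_filter_superset (r := r) (Finset.singleton_subset_iff.2 hv) (by simpa using hr)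

variable {r : ℕ} {s : Finset ℕ → ℕ} {W : Finset ℕ}

/-- All vertices of `W` lie in equally many constraints, so through this identity most wins means
fewest losses. -/
theorem wins_add_card_lost (hs : ∀ S ∈ W.powersetCard r, s S ∈ S) (v : ℕ) :
    wins r s W v + (lost r s W v).card = ((W.powersetCard r).filter fun S => v ∈ S).card := by
  rw [wins, lost, ← Finset.card_filter_add_card_filter_not (s := (W.powersetCard r).filter fun S => v ∈ S)
    (fun S => s S = v), Finset.filter_filter, Finset.filter_filter]
  congr 2
  refine Finset.filter_congr fun S hS => ⟨fun h => ⟨h ▸ hs S hS, h⟩, fun h => h.2⟩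

/-- A constraint containing both vertices selects at most one of them, so the other loses it. -/
theorem choose_le_card_lost_add {u v : ℕ} (hu : u ∈ W) (hv : v ∈ W) (huv : u ≠ v) (hr : 2 ≤ r) :
    (W.card - 2).choose (r - 2) ≤ (lost r s W u).card + (lost r s W v).card := by
  have h := card_filter_superset (W := W) (A := {u, v}) (r := r)
    (by simp [Finset.insert_subset_iff, hu, hv]) (by rw [Finset.card_pair huv]; exact hr)
  rw [Finset.card_pair huv] at h
  rw [← h]
  refine le_trans (Finset.card_le_card ?_) (Finset.card_union_le _ _)
  intro S
  simp only [lost, Finset.mem_filter, Finset.mem_union, Finset.insert_subset_iff,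
    Finset.singleton_subset_iff]
  rintro ⟨hS, h1, h2⟩
  by_cases hc : s S = u
  · exact Or.inr ⟨hS, h2, fun h => huv (hc.symm.trans h)⟩
  · exact Or.inl ⟨hS, h1, hc⟩

/-- The cost of a ranking with last vertex `v`. -/
theorem card_violated_of_last (hs : ∀ S ∈ W.powersetCard r, s S ∈ S) {g : ℕ → ℕ} {v : ℕ}
    (hlast : ∀ u ∈ W, u ≠ v → g u < g v) :
    (violated r s g W).card = (violated r s g (W.erase v)).card + (lost r s W v).card := by
  rw [← Finset.card_filter_add_card_filter_not (s := violated r s g W) (fun S => v ∉ S)]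
  congr 2
  · ext S
    simp only [violated, Finset.mem_filter, Finset.mem_powersetCard, Finset.subset_erase]
    tauto
  · ext S
    simp only [violated, lost, Finset.mem_filter, not_not]
    constructor
    · rintro ⟨⟨hS, h⟩, hv⟩
      refine ⟨hS, hv, fun he => h fun u hu hne => ?_⟩
      rw [he] at hne ⊢
      exact hlast u ((Finset.mem_powersetCard.1 hS).1 hu) hne
    · rintro ⟨hS, hv, hne⟩
      refine ⟨⟨hS, fun h => ?_⟩, hv⟩
      have h1 := h v hv (Ne.symm hne)
      have h2 := hlast (s S) ((Finset.mem_powersetCard.1 hS).1 (hs S hS)) hne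
      omega

theorem violated_congr {g g' : ℕ → ℕ} (hs : ∀ S ∈ W.powersetCard r, s S ∈ S)
    (h : ∀ u ∈ W, g u = g' u) : violated r s g W = violated r s g' W := by
  refine Finset.filter_congr fun S hS => not_congr ?_
  have hSW := (Finset.mem_powersetCard.1 hS).1
  refine forall₂_congr fun u hu => ?_
  rw [h u (hSW hu), h _ (hSW (hs S hS))]

/-- In a large instance of small cost a vertex with the largest number of wins is last. -/
theorem yesOn_iff_erase (hr : 3 ≤ r) (hs : ∀ S ∈ W.powersetCard r, s S ∈ S) {k m v : ℕ}
    (hW : 2 * k + r ≤ W.card) (hm : m ≤ k) (hv : v ∈ W)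
    (hmax : ∀ u ∈ W, wins r s W u ≤ wins r s W v) :
    YesOn r s W m ↔ (lost r s W v).card ≤ m ∧ YesOn r s (W.erase v) (m - (lost r s W v).card) := by
  constructor
  · rintro ⟨g, hg, hc⟩
    obtain ⟨u, hu, hmaxu⟩ := Finset.exists_max_image W g ⟨v, hv⟩
    have hlast : ∀ x ∈ W, x ≠ u → g x < g u := fun x hx hne =>
      lt_of_le_of_ne (hmaxu x hx) fun h => hne (hg hx hu h)
    have h1 := card_violated_of_last hs hlast
    have huv : u = v := by
      -- If another vertex `u` were last, it would lose at most `m ≤ k` constraints, and `v`, having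
      -- at least as many wins, no more than that. Together this is at most `2k`, less than the
      -- number of their common constraints.
      by_contra hne
      have h2 := choose_le_card_lost_add (s := s) hu hv hne (by omega : 2 ≤ r)
      have h3 := sub_add_one_le_choose (m := W.card - 2) (t := r - 2) (by omega) (by omega)
      have h4 := wins_add_card_lost hs u
      have h5 := wins_add_card_lost hs v
      rw [card_filter_mem hu (by omega)] at h4
      rw [card_filter_mem hv (by omega)] at h5
      have h6 := hmax u hu
      omega
    subst huv
    exact ⟨by omega, g, hg.mono (by simp), by omega⟩
  · rintro ⟨hl, g, hg, hc⟩
    -- Conversely, giving `v` a value above all others places it last.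
    have hlt : ∀ u ∈ W, g u < W.sup g + 1 := fun u hu => Nat.lt_succ_of_le (Finset.le_sup hu)
    have hlast : ∀ u ∈ W, u ≠ v →
        Function.update g v (W.sup g + 1) u < Function.update g v (W.sup g + 1) v := by
      intro u hu hne
      simpa [Function.update_of_ne hne] using hlt u hu
    refine ⟨Function.update g v (W.sup g + 1), ?_, ?_⟩
    · intro x hx y hy hxy
      by_cases h1 : x = v
      · by_cases h2 : y = v
        · rw [h1, h2]
        · have := hlast y hy h2
          rw [← hxy, h1] at this
          omega
      · by_cases h2 : y = v
        · have := hlast x hx h1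
          rw [hxy, h2] at this
          omega
        · rw [Function.update_of_ne h1, Function.update_of_ne h2] at hxy
          exact hg (by simpa [h1] using hx) (by simpa [h2] using hy) hxy
    · rw [card_violated_of_last hs hlast, violated_congr (g' := g)]
      · omega
      · exact fun S hS => hs S (Finset.powersetCard_mono (Finset.erase_subset _ _) hS)
      · intro u hu
        exact Function.update_of_ne (Finset.ne_of_mem_erase hu) _ _

theorem dead_erase {V : Finset ℕ} (hWV : W ⊆ V) (v : ℕ) :
    dead r V (W.erase v) = dead r V W + ((W.powersetCard r).filter fun S => v ∈ S).card := by
  rw [dead, ← Finset.card_filter_add_card_filter_not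
    (s := (V.powersetCard r).filter fun S => ¬ S ⊆ W.erase v) (fun S => ¬ S ⊆ W), dead]
  congr 2
  · ext S
    simp only [Finset.mem_filter, Finset.subset_erase]
    tauto
  · ext S
    simp only [Finset.mem_filter, Finset.subset_erase, Finset.mem_powersetCard]
    constructor
    · rintro ⟨⟨h1, h2⟩, h3⟩
      exact ⟨⟨not_not.1 h3, h1.2⟩, by tauto⟩
    · rintro ⟨⟨h1, h2⟩, h3⟩
      exact ⟨⟨⟨h1.trans hWV, h2⟩, by tauto⟩, by tauto⟩

/-- The set `W` is what is left of `V` after vertices with `w` wins in total were removed from the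
end of the ranking. -/
structure Peeled (r : ℕ) (s : Finset ℕ → ℕ) (V : Finset ℕ) (k : ℕ) (W : Finset ℕ) (w : ℕ) :
    Prop where
  subset : W ⊆ V
  le_dead : w ≤ dead r V W
  yes_iff : YesOn r s V k ↔ dead r V W ≤ k + w ∧ YesOn r s W (k + w - dead r V W)

theorem dead_self : dead r W W = 0 := by
  rw [dead, Finset.card_eq_zero, Finset.filter_eq_empty_iff]
  exact fun S hS => not_not.2 (Finset.mem_powersetCard.1 hS).1

theorem Peeled.refl (k : ℕ) : Peeled r s W k W 0 where
  subset := le_rfl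
  le_dead := Nat.zero_le _
  yes_iff := by simp [dead_self]

/-- Removing `v` raises `dead` by its wins plus its losses and `w` by its wins, so the budget `k + w
- dead` drops by exactly the losses. The inequality `w ≤ dead` keeps the budget at most `k`, as the
peeling step demands. -/
theorem Peeled.step (hr : 3 ≤ r) {V : Finset ℕ} {k w v : ℕ}
    (hs : ∀ S ∈ V.powersetCard r, s S ∈ S) (h : Peeled r s V k W w)
    (hW : 2 * k + r ≤ W.card) (hv : v ∈ W) (hmax : ∀ u ∈ W, wins r s W u ≤ wins r s W v) :
    Peeled r s V k (W.erase v) (w + wins r s W v) := by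
  have hs' : ∀ S ∈ W.powersetCard r, s S ∈ S := fun S hS =>
    hs S (Finset.powersetCard_mono h.subset hS)
  have h1 := dead_erase (r := r) h.subset v
  have h2 := wins_add_card_lost hs' v
  have h3 := h.le_dead
  refine ⟨(Finset.erase_subset _ _).trans h.subset, by omega, ?_⟩
  rw [h.yes_iff, yesOn_iff_erase hr hs' hW (by omega) hv hmax]
  constructor
  · rintro ⟨h4, h5, h6⟩
    exact ⟨by omega, by convert h6 using 1; omega⟩
  · rintro ⟨h4, h5⟩
    exact ⟨by omega, by omega, by convert h5 using 1; omega⟩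

/-! ### Invariance under renumbering -/

/-- Renumbering the vertices does not change the cost. -/
theorem yesOn_renumber {U : Finset ℕ} {e f : ℕ → ℕ} (hU : W = U.image e)
    (hfe : ∀ i ∈ U, f (e i) = i) (hs : ∀ S ∈ W.powersetCard r, s S ∈ S) (m : ℕ) :
    YesOn r (fun S => f (s (S.image e))) U m ↔ YesOn r s W m := by
  have he : Set.InjOn e U := fun x hx y hy h => by
    rw [← hfe x hx, ← hfe y hy, h]
  have hef : ∀ x ∈ W, e (f x) = x := by
    intro x hx
    rw [hU, Finset.mem_image] at hx
    obtain ⟨i, hi, rfl⟩ := hx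
    rw [hfe i hi]
  have himg : ∀ S ∈ U.powersetCard r, S.image e ∈ W.powersetCard r := by
    intro S hS
    rw [Finset.mem_powersetCard] at hS ⊢
    exact ⟨hU ▸ Finset.image_subset_image hS.1,
      by rw [Finset.card_image_of_injOn (he.mono (by exact_mod_cast hS.1)), hS.2]⟩
  have hfW : ∀ x ∈ W, f x ∈ U := by
    intro x hx
    rw [hU, Finset.mem_image] at hx
    obtain ⟨i, hi, rfl⟩ := hx
    rwa [hfe i hi]
  -- `S ↦ S.image e` is a bijection between the violated sets, with inverse `T ↦ T.image f`.
  have key : ∀ g : ℕ → ℕ, (violated r (fun S => f (s (S.image e))) (g ∘ e) U).card =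
      (violated r s g W).card := by
    intro g
    have hiff : ∀ S ∈ U.powersetCard r,
        ((∀ u ∈ S, u ≠ f (s (S.image e)) → (g ∘ e) u < (g ∘ e) (f (s (S.image e)))) ↔
          ∀ u ∈ S.image e, u ≠ s (S.image e) → g u < g (s (S.image e))) := by
      intro S hS
      have hSW := Finset.mem_powersetCard.1 (himg S hS)
      have hsel := hSW.1 (hs _ (himg S hS))
      simp only [Finset.forall_mem_image, Function.comp, hef _ hsel]
      refine forall₂_congr fun u hu => ?_
      have huU := (Finset.mem_powersetCard.1 hS).1 hu
      have : u ≠ f (s (S.image e)) ↔ e u ≠ s (S.image e) := by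
        refine not_congr ⟨fun h => ?_, fun h => ?_⟩
        · rw [h, hef _ hsel]
        · rw [← h, hfe u huU]
      rw [this]
    refine Finset.card_bij (fun S _ => S.image e) ?_ ?_ ?_
    · intro S hS
      rw [violated, Finset.mem_filter] at hS ⊢
      exact ⟨himg S hS.1, (not_congr (hiff S hS.1)).1 hS.2⟩
    · intro S hS T hT h
      have hSU := (Finset.mem_powersetCard.1 (Finset.mem_filter.1 hS).1).1
      have hTU := (Finset.mem_powersetCard.1 (Finset.mem_filter.1 hT).1).1
      have h' := congrArg (Finset.image f) h
      simp only [Finset.image_image] at h'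
      rwa [Finset.image_congr (f := f ∘ e) (g := id) fun x hx => hfe x (hSU hx),
        Finset.image_congr (f := f ∘ e) (g := id) fun x hx => hfe x (hTU hx), Finset.image_id,
        Finset.image_id] at h'
    · intro T hT
      rw [violated, Finset.mem_filter, Finset.mem_powersetCard] at hT
      have hTe : (T.image f).image e = T := by
        rw [Finset.image_image, Finset.image_congr (g := id)]
        · simp
        · exact fun x hx => hef x (hT.1.1 hx)
      have hTU : T.image f ∈ U.powersetCard r := by
        rw [Finset.mem_powersetCard]
        refine ⟨Finset.image_subset_iff.2 fun x hx => hfW x (hT.1.1 hx), ?_⟩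
        rw [Finset.card_image_of_injOn, hT.1.2]
        intro x hx y hy h
        rw [← hef x (hT.1.1 hx), ← hef y (hT.1.1 hy), h]
      refine ⟨T.image f, ?_, hTe⟩
      rw [violated, Finset.mem_filter]
      refine ⟨hTU, (not_congr (hiff _ hTU)).2 ?_⟩
      rw [hTe]
      exact hT.2
  constructor
  · rintro ⟨g, hg, hc⟩
    refine ⟨g ∘ f, fun x hx y hy h => ?_, ?_⟩
    · rw [← hef x hx, ← hef y hy, hg (hfW x hx) (hfW y hy) h]
    · rw [← key, violated_congr (g' := g)]
      · exact hc
      · intro S hS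
        have h1 := hs _ (himg S hS)
        rw [Finset.mem_image] at h1
        obtain ⟨i, hi, h1⟩ := h1
        rw [← h1, hfe i ((Finset.mem_powersetCard.1 hS).1 hi)]
        exact hi
      · intro u hu
        simp [hfe u hu]
  · rintro ⟨g, hg, hc⟩
    refine ⟨g ∘ e, ?_, (key g).trans_le hc⟩
    refine hg.comp he fun x hx => ?_
    rw [hU]
    exact Finset.mem_coe.2 (Finset.mem_image_of_mem e hx)

end DenseFAS

/-! ### Instances as lists of blocks -/

namespace DenseFAS

/-- Together with `sublistsLen_map`, this makes the block list of a restricted instance a filtered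
and renamed copy of the original list, in the same order. -/
theorem sublistsLen_filter {α : Type*} (p : α → Bool) (r : ℕ) (l : List α) :
    (l.filter p).sublistsLen r = (l.sublistsLen r).filter fun t => t.all p := by
  induction l generalizing r with
  | nil => cases r <;> simp [List.sublistsLen_zero, List.filter_cons]
  | cons a l ih =>
    cases r with
    | zero => simp [List.sublistsLen_zero, List.filter_cons]
    | succ r =>
      rw [List.sublistsLen_succ_cons, List.filter_append, List.filter_map, ← ih]
      by_cases ha : p a
      · rw [List.filter_cons_of_pos ha, List.sublistsLen_succ_cons, ih r]
        congr 3
        funext t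
        simp [ha]
      · rw [List.filter_cons_of_neg ha]
        have : ((fun t => t.all p) ∘ List.cons a) = fun _ => false := by
          funext t
          simp [ha]
        rw [this]
        simp

theorem sublistsLen_map {α β : Type*} (f : α → β) (r : ℕ) (l : List α) :
    (l.map f).sublistsLen r = (l.sublistsLen r).map (List.map f) := by
  induction l generalizing r with
  | nil => cases r <;> simp [List.sublistsLen_zero]
  | cons a l ih =>
    cases r with
    | zero => simp [List.sublistsLen_zero]
    | succ r =>
      rw [List.map_cons, List.sublistsLen_succ_cons, ih, ih, List.sublistsLen_succ_cons]
      simp [List.map_map, Function.comp_def]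

/-- The `r`-element sublists of `0, …, n - 1`. -/
abbrev blocks (r n : ℕ) : List (List ℕ) := (List.range n).sublistsLen r

theorem pairwise_of_mem_blocks {r n : ℕ} {l : List ℕ} (h : l ∈ blocks r n) :
    l.Pairwise (· < ·) :=
  List.pairwise_lt_range.sublist (List.mem_sublistsLen.1 h).1

theorem toFinset_mem_powersetCard {r n : ℕ} {l : List ℕ} (h : l ∈ blocks r n) :
    l.toFinset ∈ (Finset.range n).powersetCard r := by
  rw [List.mem_sublistsLen] at h
  rw [Finset.mem_powersetCard]
  refine ⟨fun x hx => ?_, ?_⟩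
  · simpa using h.1.subset (List.mem_toFinset.1 hx)
  · rw [List.toFinset_card_of_nodup (h.1.nodup List.nodup_range), h.2]

theorem toFinset_map_blocks (r n : ℕ) :
    ((blocks r n).map List.toFinset).toFinset = (Finset.range n).powersetCard r := by
  ext S
  rw [List.mem_toFinset, List.mem_map]
  constructor
  · rintro ⟨l, hl, rfl⟩
    exact toFinset_mem_powersetCard hl
  · intro hS
    rw [Finset.mem_powersetCard] at hS
    refine ⟨(List.range n).filter (· ∈ S), ?_, ?_⟩
    · rw [List.mem_sublistsLen]
      refine ⟨List.filter_sublist, ?_⟩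
      rw [← hS.2, ← List.toFinset_card_of_nodup (List.nodup_range.filter _)]
      congr 1
      ext x
      simp only [List.mem_toFinset, List.mem_filter, List.mem_range, decide_eq_true_eq]
      exact ⟨fun h => h.2, fun h => ⟨by simpa using hS.1 h, h⟩⟩
    · ext x
      simp only [List.mem_toFinset, List.mem_filter, List.mem_range, decide_eq_true_eq]
      exact ⟨fun h => h.2, fun h => ⟨by simpa using hS.1 h, h⟩⟩

/-- Blocks are strictly increasing, hence determined by their underlying sets. -/
theorem nodup_map_blocks (r n : ℕ) : ((blocks r n).map List.toFinset).Nodup := by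
  refine List.Nodup.map_on ?_ (List.nodup_sublistsLen r List.nodup_range)
  intro l hl l' hl' h
  have h1 := pairwise_of_mem_blocks hl
  have h2 := pairwise_of_mem_blocks hl'
  refine List.Perm.eq_of_pairwise (le := (· < ·)) (fun a b _ _ h h' => absurd h (lt_asymm h')) h1 h2 ?_
  exact List.perm_of_nodup_nodup_toFinset_eq (h1.imp fun h => ne_of_lt h)
    (h2.imp fun h => ne_of_lt h) h

/-- Turns counts of constraints into counts along the list that the program scans. -/
theorem card_filter_powersetCard_range (r n : ℕ) (p : Finset ℕ → Prop) [DecidablePred p] :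
    (((Finset.range n).powersetCard r).filter p).card =
      (blocks r n).countP fun l => p l.toFinset := by
  have : ((Finset.range n).powersetCard r).filter p =
      (((blocks r n).map List.toFinset).filter p).toFinset := by
    rw [List.toFinset_filter, toFinset_map_blocks]
    simp
  rw [this, List.toFinset_card_of_nodup ((nodup_map_blocks r n).filter _), ← List.countP_eq_length_filter,
    List.countP_map]
  rfl

/-- The encoding of the instance on `0, …, n - 1` with selected vertices `s`. -/
def encodeSel (r n k : ℕ) (s : Finset ℕ → ℕ) : List ℕ :=
  n :: k :: (blocks r n).flatMap fun l => l ++ [s l.toFinset]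

variable {r : ℕ}

/-- The selected vertices of an instance, for sets of numbers. -/
def Instance.selNat (R : Instance r) (S : Finset ℕ) : ℕ :=
  R.selVal (Finset.univ.filter fun i => (i : ℕ) ∈ S)

theorem image_filter_val {n : ℕ} {S : Finset ℕ} (h : S ⊆ Finset.range n) :
    (Finset.univ.filter fun i : Fin n => (i : ℕ) ∈ S).image Fin.val = S := by
  ext x
  simp only [Finset.mem_image, Finset.mem_filter, Finset.mem_univ, true_and]
  exact ⟨by rintro ⟨i, hi, rfl⟩; exact hi,
    fun hx => ⟨⟨x, by simpa using h hx⟩, hx, rfl⟩⟩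

theorem filter_val_image {n : ℕ} (S : Finset (Fin n)) :
    (Finset.univ.filter fun i : Fin n => (i : ℕ) ∈ S.image Fin.val) = S := by
  ext x
  simp [Fin.val_inj]

theorem Instance.selNat_image (R : Instance r) (S : Constraint r R.n) :
    R.selNat (S.1.image Fin.val) = R.sel S := by
  rw [selNat, filter_val_image, selVal, dif_pos S.2]

theorem card_filter_val {n : ℕ} {S : Finset ℕ} (h : S ∈ (Finset.range n).powersetCard r) :
    (Finset.univ.filter fun i : Fin n => (i : ℕ) ∈ S).card = r := by
  rw [Finset.mem_powersetCard] at h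
  rw [← h.2, ← Finset.card_image_of_injective _ Fin.val_injective, image_filter_val h.1]

theorem Instance.selNat_mem (R : Instance r) {S : Finset ℕ}
    (h : S ∈ (Finset.range R.n).powersetCard r) : R.selNat S ∈ S := by
  have := R.sel_mem ⟨_, card_filter_val h⟩
  rw [selNat, selVal, dif_pos (card_filter_val h)]
  simpa using this

theorem Instance.encode_eq (R : Instance r) : R.encode = encodeSel r R.n R.k R.selNat := by
  have h : List.range R.n = (List.finRange R.n).map Fin.val := by simp
  rw [encode, encodeSel, blocks, h, sublistsLen_map, List.flatMap_map]
  congr 3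
  funext l
  congr 2
  rw [selNat]
  congr 1
  ext x
  simp [Fin.val_inj]

/-- The cost depends only on the order that a ranking induces, so permutations may be replaced by
numerical functions; these restrict to subsets without a change of type. -/
theorem Instance.cost_eq (R : Instance r) (σ : Ranking R.n) (g : ℕ → ℕ)
    (h : ∀ i j, σ i < σ j ↔ g i < g j) :
    R.cost σ = (violated r R.selNat g (Finset.range R.n)).card := by
  have h1 : R.cost σ = (Finset.univ.filter fun S : Constraint r R.n =>
      ¬ ∀ u ∈ S.1, u ≠ R.sel S → σ u < σ (R.sel S)).card := by
    rw [cost, Finset.card_filter]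
    refine Finset.sum_congr rfl fun S _ => ?_
    simp only [c, ite_not]
  have key : ∀ S : Constraint r R.n, (∀ u ∈ S.1, u ≠ R.sel S → σ u < σ (R.sel S)) ↔
      ∀ u ∈ S.1.image Fin.val, u ≠ R.selNat (S.1.image Fin.val) →
        g u < g (R.selNat (S.1.image Fin.val)) := by
    intro S
    simp only [R.selNat_image, Finset.forall_mem_image, h, ne_eq, Fin.val_inj]
  rw [h1]
  refine Finset.card_bij (fun S _ => S.1.image Fin.val) ?_ ?_ ?_
  · intro S hS
    rw [Finset.mem_filter] at hS
    rw [violated, Finset.mem_filter, ← key, Finset.mem_powersetCard,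
      Finset.card_image_of_injective _ Fin.val_injective]
    refine ⟨⟨fun x hx => ?_, S.2⟩, hS.2⟩
    obtain ⟨i, -, rfl⟩ := Finset.mem_image.1 hx
    simp
  · intro S _ T _ hST
    exact Subtype.ext (Finset.image_injective Fin.val_injective hST)
  · intro T hT
    rw [violated, Finset.mem_filter] at hT
    have hi := image_filter_val (Finset.mem_powersetCard.1 hT.1).1
    refine ⟨⟨_, card_filter_val hT.1⟩, ?_, hi⟩
    rw [Finset.mem_filter, key]
    simp only [hi]
    exact ⟨Finset.mem_univ _, hT.2⟩

theorem Instance.isYes_iff (R : Instance r) :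
    R.IsYes ↔ YesOn r R.selNat (Finset.range R.n) R.k := by
  constructor
  · rintro ⟨σ, hσ⟩
    have hval : ∀ i : Fin R.n, (fun x => if h : x < R.n then (σ ⟨x, h⟩ : ℕ) else 0) i = σ i := by
      intro i
      simp
    refine ⟨fun x => if h : x < R.n then (σ ⟨x, h⟩ : ℕ) else 0, ?_, ?_⟩
    · intro x hx y hy hxy
      have hx' : x < R.n := by simpa using hx
      have hy' : y < R.n := by simpa using hy
      have := (hval ⟨x, hx'⟩).symm.trans (hxy.trans (hval ⟨y, hy'⟩))
      simpa using σ.injective (Fin.val_injective this)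
    · rwa [← R.cost_eq σ]
      intro i j
      simp only [Fin.is_lt, dite_true, Fin.eta, Fin.val_fin_lt]
  · rintro ⟨g, hg, hc⟩
    let f : Fin R.n → ℕ := fun i => g i
    have hf : Function.Injective f := fun i j h =>
      Fin.val_injective (hg (by simp) (by simp) h)
    -- `Tuple.sort f` sends a position to the vertex there, so its inverse is the ranking.
    have hmono : StrictMono (f ∘ Tuple.sort f) :=
      (Tuple.monotone_sort f).strictMono_of_injective (hf.comp (Tuple.sort f).injective)
    refine ⟨(Tuple.sort f)⁻¹, ?_⟩
    rwa [R.cost_eq _ g]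
    intro i j
    rw [← hmono.lt_iff_lt]
    simp [f]

/-- The instance on `0, …, n - 1` with selected vertices `s`. -/
def Instance.ofSel (n k : ℕ) (s : Finset ℕ → ℕ)
    (hs : ∀ S ∈ (Finset.range n).powersetCard r, s S ∈ S) : Instance r :=
  have h (S : Constraint r n) : s (S.1.image Fin.val) ∈ S.1.image Fin.val := by
    refine hs _ (Finset.mem_powersetCard.2 ⟨fun x hx => ?_, ?_⟩)
    · obtain ⟨i, -, rfl⟩ := Finset.mem_image.1 hx
      simp
    · rw [Finset.card_image_of_injective _ Fin.val_injective, S.2]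
  { n := n
    k := k
    sel := fun S => ⟨s (S.1.image Fin.val), by
      obtain ⟨i, -, hi⟩ := Finset.mem_image.1 (h S)
      rw [← hi]
      exact i.2⟩
    sel_mem := fun S => by
      obtain ⟨i, hi, hi'⟩ := Finset.mem_image.1 (h S)
      convert hi
      exact hi'.symm }

theorem Instance.selNat_ofSel {n k : ℕ} {s : Finset ℕ → ℕ}
    (hs : ∀ S ∈ (Finset.range n).powersetCard r, s S ∈ S) {S : Finset ℕ}
    (hS : S ∈ (Finset.range n).powersetCard r) : (ofSel n k s hs).selNat S = s S := by
  have hi := image_filter_val (Finset.mem_powersetCard.1 hS).1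
  have h : (ofSel n k s hs).selNat ((Finset.univ.filter fun i : Fin n => (i : ℕ) ∈ S).image Fin.val)
      = s ((Finset.univ.filter fun i : Fin n => (i : ℕ) ∈ S).image Fin.val) :=
    (ofSel n k s hs).selNat_image ⟨_, card_filter_val hS⟩
  rwa [hi] at h

theorem Instance.encode_ofSel {n k : ℕ} {s : Finset ℕ → ℕ}
    (hs : ∀ S ∈ (Finset.range n).powersetCard r, s S ∈ S) :
    (ofSel n k s hs).encode = encodeSel r n k s := by
  rw [encode_eq, encodeSel, encodeSel]
  change n :: k :: (blocks r n).flatMap _ = _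
  congr 2
  refine List.flatMap_congr fun l hl => ?_
  rw [selNat_ofSel hs (toFinset_mem_powersetCard hl)]

theorem Instance.isYes_ofSel {n k : ℕ} {s : Finset ℕ → ℕ}
    (hs : ∀ S ∈ (Finset.range n).powersetCard r, s S ∈ S) :
    (ofSel n k s hs).IsYes ↔ YesOn r s (Finset.range n) k := by
  rw [isYes_iff]
  change YesOn r _ (Finset.range n) k ↔ _
  refine exists_congr fun g => and_congr_right fun _ => ?_
  have : violated r (ofSel n k s hs).selNat g (Finset.range n) =
      violated r s g (Finset.range n) :=
    Finset.filter_congr fun S hS => by rw [selNat_ofSel hs hS]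
  rw [this]

/-! ### A fixed No-instance -/

/-- Selected vertices that no ranking of `r + 1` vertices satisfies. -/
def conflictSel (S : Finset ℕ) : ℕ :=
  if 1 ∈ S then if 0 ∈ S then 0 else 1 else 2

theorem conflictSel_mem (hr : 3 ≤ r) :
    ∀ S ∈ (Finset.range (r + 1)).powersetCard r, conflictSel S ∈ S := by
  intro S hS
  rw [Finset.mem_powersetCard] at hS
  rw [conflictSel]
  split_ifs with h1 h0
  · exact h0
  · exact h1
  · by_contra h2
    have : S ⊆ ((Finset.range (r + 1)).erase 1).erase 2 := by
      simp only [Finset.subset_erase]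
      exact ⟨⟨hS.1, h1⟩, h2⟩
    have := Finset.card_le_card this
    rw [Finset.card_erase_of_mem (by simp; omega), Finset.card_erase_of_mem (by simp; omega),
      Finset.card_range, hS.2] at this
    omega

theorem not_yesOn_conflictSel (hr : 3 ≤ r) :
    ¬ YesOn r conflictSel (Finset.range (r + 1)) 0 := by
  rintro ⟨g, hg, hc⟩
  rw [Nat.le_zero, Finset.card_eq_zero, violated, Finset.filter_eq_empty_iff] at hc
  simp only [not_not] at hc
  have key : ∀ a < r + 1, ∀ u < r + 1, u ≠ a →
      u ≠ conflictSel ((Finset.range (r + 1)).erase a) →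
        g u < g (conflictSel ((Finset.range (r + 1)).erase a)) := by
    intro a ha u hu hua hne
    refine hc (x := (Finset.range (r + 1)).erase a) ?_ u (by simp [hu, hua]) hne
    rw [Finset.mem_powersetCard, Finset.card_erase_of_mem (by simpa using ha), Finset.card_range]
    exact ⟨Finset.erase_subset _ _, rfl⟩
  -- Omitting `1` forces `0` before `2`; omitting `3`, which is a vertex since `r ≥ 3`, forces `2`
  -- before `0`.
  have h1 : conflictSel ((Finset.range (r + 1)).erase 1) = 2 := by simp [conflictSel]
  have h2 : conflictSel ((Finset.range (r + 1)).erase 3) = 0 := by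
    simp [conflictSel]
    omega
  have h3 := key 1 (by omega) 0 (by omega) (by omega) (by rw [h1]; omega)
  have h4 := key 3 (by omega) 2 (by omega) (by omega) (by rw [h2]; omega)
  rw [h1] at h3
  rw [h2] at h4
  omega

/-- An instance with `r + 1` vertices that is not a `Yes`-instance. -/
def Instance.conflict (hr : 3 ≤ r) : Instance r :=
  ofSel (r + 1) 0 conflictSel (conflictSel_mem hr)

theorem Instance.not_isYes_conflict (hr : 3 ≤ r) : ¬ (conflict hr).IsYes := by
  rw [conflict, isYes_ofSel]
  exact not_yesOn_conflictSel hr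

/-! ### Restriction to a set of vertices -/

theorem map_count_filter_range (p : ℕ → Prop) [DecidablePred p] (n : ℕ) :
    ((List.range n).filter p).map (Nat.count p) = List.range (Nat.count p n) := by
  induction n with
  | zero => simp
  | succ n ih =>
    rw [List.range_succ, List.filter_append, List.map_append, ih, Nat.count_succ]
    by_cases h : p n <;> simp [h, List.range_succ]

theorem count_mem_eq_card {n : ℕ} {W : Finset ℕ} (hW : W ⊆ Finset.range n) :
    Nat.count (· ∈ W) n = W.card := by
  rw [Nat.count_eq_card_filter_range]
  congr 1
  ext x
  simp only [Finset.mem_filter]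
  exact ⟨fun h => h.2, fun h => ⟨hW h, h⟩⟩

/-- The restriction of the selected vertices to `W`, whose vertices are renamed in increasing
order. -/
noncomputable def restrictSel (s : Finset ℕ → ℕ) (W S : Finset ℕ) : ℕ :=
  Nat.count (· ∈ W) (s (S.image (Nat.nth (· ∈ W))))

theorem image_nth_range (W : Finset ℕ) : (Finset.range W.card).image (Nat.nth (· ∈ W)) = W := by
  have hf : {x | x ∈ W}.Finite := W.finite_toSet
  have hc : hf.toFinset.card = W.card := congrArg _ W.finite_toSet_toFinset
  ext x
  rw [Finset.mem_image]
  constructor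
  · rintro ⟨i, hi, rfl⟩
    exact Nat.nth_mem (p := (· ∈ W)) i fun hf' => by
      rw [show hf'.toFinset.card = W.card from hc]
      simpa using hi
  · intro hx
    obtain ⟨i, hi, hix⟩ := Nat.exists_lt_card_nth_eq (p := (· ∈ W)) hx
    exact ⟨i, by rw [Finset.mem_range, ← hc]; exact hi hf, hix⟩

theorem count_nth_of_lt_card {W : Finset ℕ} {i : ℕ} (hi : i ∈ Finset.range W.card) :
    Nat.count (· ∈ W) (Nat.nth (· ∈ W) i) = i := by
  refine Nat.count_nth fun hf => ?_
  have hc : hf.toFinset.card = W.card := congrArg _ W.finite_toSet_toFinset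
  rw [hc]
  simpa using hi

theorem restrictSel_mem {s : Finset ℕ → ℕ} {W : Finset ℕ}
    (hs : ∀ S ∈ W.powersetCard r, s S ∈ S) :
    ∀ S ∈ (Finset.range W.card).powersetCard r, restrictSel s W S ∈ S := by
  intro S hS
  rw [Finset.mem_powersetCard] at hS
  have hinj : Set.InjOn (Nat.nth (· ∈ W)) S := fun x hx y hy h => by
    rw [← count_nth_of_lt_card (hS.1 hx), ← count_nth_of_lt_card (hS.1 hy), h]
  have h := hs (S.image (Nat.nth (· ∈ W))) (Finset.mem_powersetCard.2
    ⟨(Finset.image_subset_image hS.1).trans_eq (image_nth_range W),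
      by rw [Finset.card_image_of_injOn hinj, hS.2]⟩)
  rw [Finset.mem_image] at h
  obtain ⟨i, hi, h⟩ := h
  rw [restrictSel, ← h, count_nth_of_lt_card (hS.1 hi)]
  exact hi

/-- `Nat.count` renames the kept vertices increasingly, with inverse `Nat.nth`, so filtering and
renaming commute with listing blocks. One pass over the input blocks therefore outputs the encoding.
-/
theorem encodeSel_restrictSel {s : Finset ℕ → ℕ} {n : ℕ} {W : Finset ℕ}
    (hW : W ⊆ Finset.range n) (k : ℕ) :
    encodeSel r W.card k (restrictSel s W) = W.card :: k ::
      ((blocks r n).filter fun l => l.all (· ∈ W)).flatMap fun l =>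
        l.map (Nat.count (· ∈ W)) ++ [Nat.count (· ∈ W) (s l.toFinset)] := by
  rw [encodeSel, blocks, ← count_mem_eq_card hW, ← map_count_filter_range, sublistsLen_map,
    List.flatMap_map, sublistsLen_filter]
  congr 2
  refine List.flatMap_congr fun l hl => ?_
  rw [List.mem_filter, List.all_eq_true] at hl
  have h : (l.map (Nat.count (· ∈ W))).toFinset.image (Nat.nth (· ∈ W)) = l.toFinset := by
    rw [show (l.map (Nat.count (· ∈ W))).toFinset = l.toFinset.image (Nat.count (· ∈ W)) by
      ext; simp, Finset.image_image, Finset.image_congr (g := id), Finset.image_id]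
    intro x hx
    exact Nat.nth_count (p := (· ∈ W)) (by simpa using hl.2 x (by simpa using hx))
  rw [restrictSel, h]

end DenseFAS

/-! ### A program logic with time bounds -/

namespace RAM

/-- Started in `s`, the program `p` halts after at most `T` steps in a store that satisfies `Q`. -/
def Exec (p : Prog) (s : Store) (T : ℕ) (Q : Store → Prop) : Prop :=
  ∃ (s' : Store) (t : ℕ), Runs p s s' t ∧ t ≤ T ∧ Q s'

/-- The store after an assignment to a register. -/
def Store.setVar (s : Store) (x m : ℕ) : Store :=
  { s with var := Function.update s.var x m }

/-- The store after a write to an array. -/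
def Store.setArr (s : Store) (a i m : ℕ) : Store :=
  { s with arr := Function.update s.arr a (Function.update (s.arr a) i m) }

@[simp] theorem Store.setVar_var (s : Store) (x m y : ℕ) :
    (s.setVar x m).var y = if y = x then m else s.var y :=
  Function.update_apply _ _ _ _

@[simp] theorem Store.setVar_arr (s : Store) (x m : ℕ) : (s.setVar x m).arr = s.arr := rfl

@[simp] theorem Store.setArr_var (s : Store) (a i m : ℕ) : (s.setArr a i m).var = s.var := rfl

theorem Store.setArr_arr (s : Store) (a i m b j : ℕ) :
    (s.setArr a i m).arr b j = if b = a ∧ j = i then m else s.arr b j := by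
  simp only [setArr, Function.update_apply]
  by_cases hb : b = a
  · subst hb
    simp [Function.update_apply]
  · simp [hb]

theorem Store.setArr_arr_of_ne (s : Store) (a i m : ℕ) {b : ℕ} (h : b ≠ a) :
    (s.setArr a i m).arr b = s.arr b :=
  Function.update_of_ne h _ _

variable {p q : Prog} {s : Store} {T T' : ℕ} {Q Q' : Store → Prop} {e : Expr}

theorem Exec.mono (h : Exec p s T Q) (hT : T ≤ T') (hQ : ∀ s', Q s' → Q' s') : Exec p s T' Q' := by
  obtain ⟨s', t, h1, h2, h3⟩ := h
  exact ⟨s', t, h1, h2.trans hT, hQ s' h3⟩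

theorem Exec.skip (h : Q s) : Exec .skip s 1 Q := ⟨s, 1, .skip s, le_rfl, h⟩

theorem Exec.assign {x : ℕ} (h : Q (s.setVar x (e.eval s))) : Exec (.assign x e) s 1 Q :=
  ⟨_, 1, .assign s x e, le_rfl, h⟩

theorem Exec.write {a : ℕ} {i : Expr} (h : Q (s.setArr a (i.eval s) (e.eval s))) :
    Exec (.write a i e) s 1 Q :=
  ⟨_, 1, .write s a i e, le_rfl, h⟩

theorem Exec.seq (h : Exec p s T fun s' => Exec q s' T' Q) : Exec (.seq p q) s (T + T') Q := by
  obtain ⟨s', t, h1, h2, s'', t', h3, h4, h5⟩ := h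
  exact ⟨s'', t + t', .seq h1 h3, by omega, h5⟩

theorem Exec.cond (h1 : e.eval s ≠ 0 → Exec p s T Q) (h2 : e.eval s = 0 → Exec q s T Q) :
    Exec (.cond e p q) s (T + 1) Q := by
  by_cases he : e.eval s = 0
  · obtain ⟨s', t, h, ht, hQ⟩ := h2 he
    exact ⟨s', t + 1, .cond_false he h, by omega, hQ⟩
  · obtain ⟨s', t, h, ht, hQ⟩ := h1 he
    exact ⟨s', t + 1, .cond_true he h, by omega, hQ⟩

/-- A loop with an invariant that counts the `N` passes. -/
theorem Exec.loop (I : ℕ → Store → Prop) (N : ℕ) (hdone : ∀ s, I N s → e.eval s = 0)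
    (hstep : ∀ i < N, ∀ s, I i s → e.eval s ≠ 0 ∧ Exec p s T (I (i + 1))) (h0 : I 0 s) :
    Exec (.loop e p) s (N * (T + 1) + 1) (I N) := by
  suffices h : ∀ d i s, i + d = N → I i s → Exec (.loop e p) s (d * (T + 1) + 1) (I N) from
    h N 0 s (by omega) h0
  intro d
  induction d with
  | zero =>
    intro i s hi hI
    obtain rfl : i = N := by omega
    exact ⟨s, 1, .loop_done (hdone s hI), by omega, hI⟩
  | succ d ih =>
    intro i s hi hI
    obtain ⟨he, s', t, h1, h2, h3⟩ := hstep i (by omega) s hI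
    obtain ⟨s'', t', h4, h5, h6⟩ := ih (i + 1) s' (by omega) h3
    exact ⟨s'', t + t' + 1, .loop_step he h1 h4, by rw [Nat.add_mul]; omega, h6⟩

/-- Append the value of `e` to the output. -/
def push (e : Expr) : Prog :=
  .seq (.write 0 (.var 0) e) (.assign 0 (.add (.var 0) (.lit 1)))

/-- Append the values of some expressions to the output. -/
def pushAll : List Expr → Prog
  | [] => .skip
  | e :: es => .seq (push e) (pushAll es)

/-- The stores agree except for their outputs. -/
def SameBesideOutput (s s' : Store) : Prop :=
  (∀ a, a ≠ 0 → s'.arr a = s.arr a) ∧ ∀ x, x ≠ 0 → s'.var x = s.var x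

/-- The value of the expression does not depend on the output. -/
def IgnoresOutput (e : Expr) : Prop :=
  ∀ s s', SameBesideOutput s s' → e.eval s' = e.eval s

theorem Exec.push : Exec (push e) s 2 fun s' =>
    s'.output = s.output ++ [e.eval s] ∧ SameBesideOutput s s' := by
  refine Exec.seq (T := 1) (T' := 1) (Exec.write (Exec.assign ⟨?_, ?_, ?_⟩))
  · simp only [Store.output, Expr.eval, Store.setVar_var, Store.setArr_var, if_true,
      Store.setVar_arr, List.range_succ, List.map_append, List.map_cons, List.map_nil]
    congr 1
    · refine List.map_congr_left fun i hi => ?_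
      rw [Store.setArr_arr, if_neg]
      rw [List.mem_range] at hi
      omega
    · simp [Store.setArr_arr]
  · intro a ha
    rw [Store.setVar_arr, Store.setArr_arr_of_ne _ _ _ _ ha]
  · intro x hx
    simp [hx]

theorem SameBesideOutput.trans {s₁ s₂ s₃ : Store} (h : SameBesideOutput s₁ s₂)
    (h' : SameBesideOutput s₂ s₃) : SameBesideOutput s₁ s₃ :=
  ⟨fun a ha => (h'.1 a ha).trans (h.1 a ha), fun x hx => (h'.2 x hx).trans (h.2 x hx)⟩

/-- Each push changes `A₀` and `x₀`; ignoring the output guarantees that later expressions still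
have their initial values. -/
theorem Exec.pushAll {es : List Expr} (he : ∀ e ∈ es, IgnoresOutput e) :
    Exec (pushAll es) s (2 * es.length + 1) fun s' =>
      s'.output = s.output ++ es.map (Expr.eval s) ∧ SameBesideOutput s s' := by
  induction es generalizing s with
  | nil => exact Exec.skip ⟨by simp, fun _ _ => rfl, fun _ _ => rfl⟩
  | cons e es ih =>
    refine Exec.mono (Exec.seq (Exec.push.mono le_rfl ?_)) (T := 2 + (2 * es.length + 1))
      (by rw [List.length_cons]; omega) fun _ h => h
    rintro s₁ ⟨h1, h2⟩
    refine (ih fun e' h' => he e' (List.mem_cons_of_mem _ h')).mono le_rfl ?_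
    rintro s₂ ⟨h3, h4⟩
    refine ⟨?_, h2.trans h4⟩
    rw [h3, h1, List.map_cons, List.append_assoc, List.singleton_append]
    congr 2
    exact List.map_congr_left fun e' h' => he e' (List.mem_cons_of_mem _ h') _ _ h2

/-- The sum of a list of expressions. -/
def Expr.sum : List Expr → Expr
  | [] => .lit 0
  | e :: es => .add e (Expr.sum es)

theorem Expr.eval_sum_eq_zero {es : List Expr} :
    (Expr.sum es).eval s = 0 ↔ ∀ e ∈ es, e.eval s = 0 := by
  induction es with
  | nil => simp [Expr.sum, Expr.eval]
  | cons e es ih => simp [Expr.sum, Expr.eval, ih]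

/-- Let `x₃` run through the numbers less than the value of `e`. -/
def forVar (e : Expr) (p : Prog) : Prog :=
  .seq (.assign 3 (.lit 0)) (.loop (.sub e (.var 3)) (.seq p (.assign 3 (.add (.var 3) (.lit 1)))))

/-- The loop itself writes its control register, so the invariant must survive any change of `x₃`,
while the body must hand `x₃` back unchanged. -/
theorem Exec.forVar (I : ℕ → Store → Prop) (N : ℕ)
    (hI : ∀ i s m, I i s → I i (s.setVar 3 m)) (he : ∀ i s, I i s → e.eval s = N)
    (hstep : ∀ i < N, ∀ s, I i s → s.var 3 = i →
      Exec p s T fun s' => I (i + 1) s' ∧ s'.var 3 = i) (h0 : I 0 s) :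
    Exec (forVar e p) s (N * (T + 2) + 2) (I N) := by
  refine (Exec.seq (T := 1) (T' := N * (T + 1 + 1) + 1) (Exec.assign ?_)).mono (by ring_nf; omega)
    fun _ h => h
  refine (Exec.loop (fun i s => I i s ∧ s.var 3 = i) N ?_ ?_ ⟨hI _ _ _ h0, by simp [Expr.eval]⟩).mono
    le_rfl fun _ h => h.1
  · rintro s ⟨h1, h2⟩
    simp [Expr.eval, he _ _ h1, h2]
  · rintro i hi s ⟨h1, h2⟩
    refine ⟨by simp [Expr.eval, he _ _ h1, h2]; omega, Exec.seq ((hstep i hi s h1 h2).mono le_rfl ?_)⟩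
    rintro s' ⟨h3, h4⟩
    exact Exec.assign ⟨hI _ _ _ h3, by simp [Expr.eval, h4]⟩

/-- Let `x₂` run through the positions `2 + d * i < x₁`. -/
def forBlock (d : ℕ) (p : Prog) : Prog :=
  .seq (.assign 2 (.lit 2))
    (.loop (.sub (.var 1) (.var 2)) (.seq p (.assign 2 (.add (.var 2) (.lit d)))))

theorem Exec.forBlock (I : ℕ → Store → Prop) {d M : ℕ} (hd : 0 < d)
    (hI : ∀ i s m, I i s → I i (s.setVar 2 m)) (he : ∀ i s, I i s → s.var 1 = 2 + d * M)
    (hstep : ∀ i < M, ∀ s, I i s → s.var 2 = 2 + d * i →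
      Exec p s T fun s' => I (i + 1) s' ∧ s'.var 2 = 2 + d * i) (h0 : I 0 s) :
    Exec (forBlock d p) s (M * (T + 2) + 2) (I M) := by
  refine (Exec.seq (T := 1) (T' := M * (T + 1 + 1) + 1) (Exec.assign ?_)).mono (by ring_nf; omega)
    fun _ h => h
  refine (Exec.loop (fun i s => I i s ∧ s.var 2 = 2 + d * i) M ?_ ?_
    ⟨hI _ _ _ h0, by simp [Expr.eval]⟩).mono le_rfl fun _ h => h.1
  · rintro s ⟨h1, h2⟩
    simp [Expr.eval, he _ _ h1, h2]
  · rintro i hi s ⟨h1, h2⟩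
    have := Nat.mul_lt_mul_of_pos_left hi hd
    refine ⟨by simp [Expr.eval, he _ _ h1, h2]; omega, Exec.seq ((hstep i hi s h1 h2).mono le_rfl ?_)⟩
    rintro s' ⟨h3, h4⟩
    exact Exec.assign ⟨hI _ _ _ h3, by simp [Expr.eval, h4]; ring⟩

end RAM

/-! ### The kernelization program and its correctness -/

namespace DenseFAS

open RAM

/-- Is the block at `x₂` not contained in the set of vertices that are left (array `A₁`)? -/
def deadExpr (r : ℕ) : Expr :=
  Expr.sum ((List.range r).map fun j => .get 1 (.get 3 (.add (.var 2) (.lit j))))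

/-- The selected vertex of the block at `x₂`. -/
def selExpr (r : ℕ) : Expr := .get 3 (.add (.var 2) (.lit r))

/-- Let `x₄` be the number of wins of `x₃`. -/
def countWins (r : ℕ) : Prog :=
  .seq (.assign 4 (.lit 0)) (forBlock (r + 1)
    (.cond (.add (deadExpr r) (.add (.sub (selExpr r) (.var 3)) (.sub (.var 3) (selExpr r))))
      .skip (.assign 4 (.add (.var 4) (.lit 1)))))

/-- Let `x₆` be a vertex with the largest number of wins, and `x₅` this number. -/
def argmaxWins (r : ℕ) : Prog :=
  .seq (.assign 5 (.lit 0)) (forVar (.get 3 (.lit 0)) (.seq (countWins r)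
    (.cond (.sub (.var 4) (.var 5)) (.seq (.assign 5 (.var 4)) (.assign 6 (.var 3))) .skip)))

/-- Copy the input to `A₃`. -/
def load : Prog :=
  .seq (.assign 1 (.var 0)) (.seq (forVar (.var 1) (.write 3 (.var 3) (.get 0 (.var 3))))
    (.assign 8 (.get 3 (.lit 0))))

/-- Remove vertices (array `A₁`) from the end of the ranking; `x₇` is the total number of their wins
and `x₈` the number of vertices that are left. -/
def peel (r : ℕ) : Prog :=
  .loop (.sub (.var 8) (.add (.get 3 (.lit 1)) (.add (.get 3 (.lit 1)) (.lit (r - 1)))))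
    (.seq (argmaxWins r) (.seq (.write 1 (.var 6) (.lit 1))
      (.seq (.assign 7 (.add (.var 7) (.var 5))) (.assign 8 (.sub (.var 8) (.lit 1))))))

/-- Compute the new names of the vertices that are left (array `A₂`). -/
def rename : Prog :=
  .seq (.assign 4 (.lit 0)) (forVar (.get 3 (.lit 0)) (.seq (.write 2 (.var 3) (.var 4))
    (.cond (.get 1 (.var 3)) .skip (.assign 4 (.add (.var 4) (.lit 1))))))

/-- Let `x₁₀` be the number of blocks that are not contained in the set of vertices left. -/
def countDead (r : ℕ) : Prog :=
  .seq (.assign 10 (.lit 0))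
    (forBlock (r + 1) (.cond (deadExpr r) (.assign 10 (.add (.var 10) (.lit 1))) .skip))

/-- The entries of the block at `x₂` under their new names. -/
def blockExprs (r : ℕ) : List Expr :=
  ((List.range r).map fun j => .get 2 (.get 3 (.add (.var 2) (.lit j)))) ++ [.get 2 (selExpr r)]

/-- Output the renamed instance. -/
def outputRestriction (r : ℕ) : Prog :=
  .seq (pushAll [.var 8, .sub (.add (.get 3 (.lit 1)) (.var 7)) (.var 10)])
    (forBlock (r + 1) (.cond (deadExpr r) .skip (pushAll (blockExprs r))))

/-- The kernelization; `out` is the encoding of some `No`-instance. -/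
def kernelize (r : ℕ) (out : List ℕ) : Prog :=
  .seq load (.seq (peel r) (.seq rename (.seq (countDead r) (.seq (.assign 0 (.lit 0))
    (.cond (.sub (.var 10) (.add (.get 3 (.lit 1)) (.var 7)))
      (pushAll (out.map .lit)) (outputRestriction r))))))

/-- The array `A₃` holds the encoded instance. -/
structure Loaded (r n k : ℕ) (s : Finset ℕ → ℕ) (σ : Store) : Prop where
  n_eq : σ.arr 3 0 = n
  k_eq : σ.arr 3 1 = k
  length_eq : σ.var 1 = 2 + (r + 1) * (blocks r n).length
  block_eq : ∀ i (hi : i < (blocks r n).length),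
    (List.range r).map (fun j => σ.arr 3 (2 + (r + 1) * i + j)) = (blocks r n)[i]
  sel_eq : ∀ i (hi : i < (blocks r n).length),
    σ.arr 3 (2 + (r + 1) * i + r) = s (blocks r n)[i].toFinset

/-- The array `A₁` marks the vertices that are not in `W`. -/
def Flagged (n : ℕ) (W : Finset ℕ) (σ : Store) : Prop :=
  ∀ v < n, σ.arr 1 v = if v ∈ W then 0 else 1

variable {r n k : ℕ} {s : Finset ℕ → ℕ} {W : Finset ℕ} {σ σ' : Store}

theorem Loaded.congr (h : Loaded r n k s σ) (ha : σ'.arr 3 = σ.arr 3) (hv : σ'.var 1 = σ.var 1) :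
    Loaded r n k s σ' := by
  refine ⟨?_, ?_, ?_, ?_, ?_⟩
  · rw [ha, h.n_eq]
  · rw [ha, h.k_eq]
  · rw [hv, h.length_eq]
  · rw [ha]; exact h.block_eq
  · rw [ha]; exact h.sel_eq

theorem Flagged.congr (h : Flagged n W σ) (ha : σ'.arr 1 = σ.arr 1) : Flagged n W σ' := by
  rw [Flagged, ha]; exact h

/-- A sum of natural-number flags vanishes exactly if each of them does. -/
theorem eval_deadExpr (hl : Loaded r n k s σ) (hf : Flagged n W σ) {i : ℕ}
    (hi : i < (blocks r n).length) (h2 : σ.var 2 = 2 + (r + 1) * i) :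
    (deadExpr r).eval σ = 0 ↔ ((blocks r n)[i].all (· ∈ W)) = true := by
  have hmem : (blocks r n)[i] ∈ blocks r n := List.getElem_mem hi
  have hlt : ∀ v ∈ (blocks r n)[i], v < n := fun v hv => by
    simpa using (List.mem_sublistsLen.1 hmem).1.subset hv
  have h : (deadExpr r).eval σ = 0 ↔ ∀ v ∈ (blocks r n)[i], σ.arr 1 v = 0 := by
    rw [deadExpr, Expr.eval_sum_eq_zero, ← hl.block_eq i hi]
    simp [Expr.eval, h2]
  rw [h, List.all_eq_true]
  refine forall₂_congr fun v hv => ?_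
  rw [hf v (hlt v hv)]
  by_cases hW : v ∈ W <;> simp [hW]

theorem eval_selExpr (hl : Loaded r n k s σ) {i : ℕ}
    (hi : i < (blocks r n).length) (h2 : σ.var 2 = 2 + (r + 1) * i) :
    (selExpr r).eval σ = s (blocks r n)[i].toFinset := by
  rw [← hl.sel_eq i hi, selExpr]
  simp [Expr.eval, h2]

theorem countP_take_succ {α : Type*} (p : α → Bool) (l : List α) {i : ℕ} (hi : i < l.length) :
    (l.take (i + 1)).countP p = (l.take i).countP p + if p l[i] then 1 else 0 := by
  rw [← List.take_concat_get' l i hi, List.countP_append]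
  simp [List.countP_singleton]

theorem all_mem_iff (l : List ℕ) (W : Finset ℕ) : l.all (· ∈ W) = true ↔ l.toFinset ⊆ W := by
  simp [Finset.subset_iff]

theorem wins_eq_countP (hW : W ⊆ Finset.range n) (v : ℕ) :
    wins r s W v =
      (blocks r n).countP fun l => l.all (· ∈ W) && decide (s l.toFinset = v) := by
  have h : (W.powersetCard r).filter (fun S => s S = v) =
      ((Finset.range n).powersetCard r).filter fun S => S ⊆ W ∧ s S = v := by
    ext S
    simp only [Finset.mem_filter, Finset.mem_powersetCard]
    exact ⟨fun h => ⟨⟨h.1.1.trans hW, h.1.2⟩, h.1.1, h.2⟩, fun h => ⟨⟨h.2.1, h.1.2⟩, h.2.2⟩⟩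
  rw [wins, h, card_filter_powersetCard_range]
  refine List.countP_congr fun l _ => ?_
  rw [decide_eq_true_eq, Bool.and_eq_true, all_mem_iff, decide_eq_true_eq]

theorem dead_eq_countP (W : Finset ℕ) :
    dead r (Finset.range n) W = (blocks r n).countP fun l => !l.all (· ∈ W) := by
  rw [dead, card_filter_powersetCard_range]
  refine List.countP_congr fun l _ => ?_
  rw [decide_eq_true_eq, Bool.not_eq_true', ← Bool.not_eq_true, all_mem_iff]

/-- The test adds to the dead flags both truncated differences of the selected vertex and `x₃`. It
vanishes exactly for a block inside `W` that `x₃` wins. -/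
theorem exec_countWins (hl : Loaded r n k s σ) (hf : Flagged n W σ) (hW : W ⊆ Finset.range n) :
    Exec (countWins r) σ (4 * (blocks r n).length + 3) fun σ' =>
      σ'.arr = σ.arr ∧ (∀ x, x ≠ 2 → x ≠ 4 → σ'.var x = σ.var x) ∧
        σ'.var 4 = wins r s W (σ.var 3) := by
  refine (Exec.seq (T := 1) (Exec.assign (Exec.forBlock (T := 2) (M := (blocks r n).length)
    (fun i σ' => σ'.arr = σ.arr ∧ (∀ x, x ≠ 2 → x ≠ 4 → σ'.var x = σ.var x) ∧
      σ'.var 4 = ((blocks r n).take i).countP fun l =>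
        l.all (· ∈ W) && decide (s l.toFinset = σ.var 3)) (Nat.succ_pos r) ?_ ?_ ?_ ?_))).mono
    (by omega) ?_
  · rintro i σ' m ⟨h1, h2, h3⟩
    exact ⟨h1, fun x hx hx' => by simp [hx, h2 x hx hx'], by simp [h3]⟩
  · rintro i σ' ⟨h1, h2, h3⟩
    rw [h2 1 (by decide) (by decide), hl.length_eq]
  · rintro i hi σ' ⟨h1, h2, h3⟩ hp
    have hl' := hl.congr (congrFun h1 3) (h2 1 (by decide) (by decide))
    have hf' := hf.congr (congrFun h1 1)
    have he := eval_deadExpr hl' hf' hi hp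
    have hsel := eval_selExpr hl' hi hp
    have h3v := h2 3 (by decide) (by decide)
    refine Exec.cond (T := 1) (fun hc => Exec.skip ⟨⟨h1, h2, ?_⟩, hp⟩)
      (fun hc => Exec.assign ⟨⟨h1, ?_, ?_⟩, ?_⟩)
    · rw [countP_take_succ _ _ hi, h3, if_neg, Nat.add_zero]
      rw [Bool.and_eq_true, decide_eq_true_eq, ← he, ← hsel]
      rintro ⟨h4, h5⟩
      simp [Expr.eval, h4, h5, h3v] at hc
    · intro x hx hx'
      simp [hx', h2 x hx hx']
    · rw [countP_take_succ _ _ hi, if_pos]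
      · simp [Expr.eval, h3]
      · rw [Bool.and_eq_true, decide_eq_true_eq, ← he, ← hsel]
        simp only [Expr.eval, h3v] at hc
        omega
    · simp [hp]
  · exact ⟨rfl, fun x hx hx' => by simp [hx'], by simp [Expr.eval]⟩
  · rintro σ' ⟨h1, h2, h3⟩
    rw [List.take_length] at h3
    exact ⟨h1, h2, h3.trans (wins_eq_countP hW _).symm⟩

/-- The scan includes removed vertices. The register `x₆` is meaningful only if some win was found,
hence the proviso in the last clause. -/
theorem exec_argmaxWins (hl : Loaded r n k s σ) (hf : Flagged n W σ) (hW : W ⊆ Finset.range n) :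
    Exec (argmaxWins r) σ (n * (4 * (blocks r n).length + 8) + 3) fun σ' =>
      σ'.arr = σ.arr ∧ (∀ x, x ∉ [2, 3, 4, 5, 6] → σ'.var x = σ.var x) ∧
        (∀ u < n, wins r s W u ≤ σ'.var 5) ∧
          (σ'.var 5 ≠ 0 → wins r s W (σ'.var 6) = σ'.var 5) := by
  refine (Exec.seq (T := 1) (Exec.assign (Exec.forVar (N := n) (T := 4 * (blocks r n).length + 6)
    (fun i σ' => σ'.arr = σ.arr ∧ (∀ x, x ∉ [2, 3, 4, 5, 6] → σ'.var x = σ.var x) ∧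
        (∀ u < i, wins r s W u ≤ σ'.var 5) ∧
          (σ'.var 5 ≠ 0 → wins r s W (σ'.var 6) = σ'.var 5)) ?_ ?_ ?_ ?_))).mono
    (by ring_nf; omega) ?_
  · rintro i σ' m ⟨h1, h2, h3, h4⟩
    refine ⟨h1, fun x hx => ?_, by simpa using h3, by simpa using h4⟩
    rw [← h2 x hx]
    simp only [List.mem_cons, not_or] at hx
    simp [hx.2.1]
  · rintro i σ' ⟨h1, -⟩
    simp [Expr.eval, h1, hl.n_eq]
  · rintro i hi σ' ⟨h1, h2, h3, h4⟩ hp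
    have hl' := hl.congr (congrFun h1 3) (h2 1 (by decide))
    have hf' := hf.congr (congrFun h1 1)
    refine (Exec.seq ((exec_countWins hl' hf' hW).mono le_rfl ?_)).mono
      (T := 4 * (blocks r n).length + 3 + 3) le_rfl fun _ h => h
    rintro τ ⟨g1, g2, g3⟩
    rw [hp] at g3
    have e3 : τ.var 3 = i := by rw [g2 3 (by decide) (by decide), hp]
    have e5 : τ.var 5 = σ'.var 5 := g2 5 (by decide) (by decide)
    have e6 : τ.var 6 = σ'.var 6 := g2 6 (by decide) (by decide)
    have hvar : ∀ x, x ∉ [2, 3, 4, 5, 6] → τ.var x = σ.var x := by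
      intro x hx
      rw [← h2 x hx]
      simp only [List.mem_cons, not_or] at hx
      exact g2 x hx.1 hx.2.2.1
    refine Exec.cond (T := 2)
      (fun hc => Exec.seq (T := 1) (Exec.assign (Exec.assign ⟨⟨g1.trans h1, ?_, ?_, ?_⟩, ?_⟩)))
      (fun hc => (Exec.skip ⟨⟨g1.trans h1, hvar, ?_, ?_⟩, e3⟩).mono (by decide) fun _ h => h)
    · intro x hx
      rw [← hvar x hx]
      simp only [List.mem_cons, not_or] at hx
      simp [hx]
    · intro u hu
      simp only [Expr.eval, Nat.sub_ne_zero_iff_lt] at hc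
      simp only [Expr.eval, Store.setVar_var, if_true, if_false, Nat.reduceEqDiff]
      rcases Nat.lt_succ_iff_lt_or_eq.1 hu with h | rfl
      · have := h3 u h
        omega
      · rw [g3]
    · intro _
      simp [Expr.eval, e3, g3]
    · simp [e3]
    · intro u hu
      simp only [Expr.eval] at hc
      rcases Nat.lt_succ_iff_lt_or_eq.1 hu with h | rfl
      · have := h3 u h
        omega
      · omega
    · rw [e5, e6]
      exact h4
  · refine ⟨rfl, fun x hx => ?_, fun u hu => absurd hu (Nat.not_lt_zero u), ?_⟩
    · simp only [List.mem_cons, not_or] at hx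
      simp [hx]
    · simp [Expr.eval]
  · exact fun _ h => h

/-- The state of the machine after some vertices were removed. -/
structure PeelState (r n k : ℕ) (s : Finset ℕ → ℕ) (W : Finset ℕ) (w : ℕ) (σ : Store) : Prop where
  loaded : Loaded r n k s σ
  flagged : Flagged n W σ
  peeled : Peeled r s (Finset.range n) k W w
  wins_eq : σ.var 7 = w
  card_eq : σ.var 8 = W.card

/-- Makes the maximum positive while peeling, so that the vertex found wins a constraint inside `W`
and thus belongs to `W`. -/
theorem exists_wins_pos (hr : r ≤ W.card) (hs : ∀ S ∈ W.powersetCard r, s S ∈ S) :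
    ∃ u ∈ W, 0 < wins r s W u := by
  obtain ⟨S, hS⟩ := Finset.powersetCard_nonempty.2 hr
  exact ⟨s S, (Finset.mem_powersetCard.1 hS).1 (hs S hS),
    Finset.card_pos.2 ⟨S, Finset.mem_filter.2 ⟨hS, rfl⟩⟩⟩

theorem exec_peel (hr : 3 ≤ r) (hs : ∀ S ∈ (Finset.range n).powersetCard r, s S ∈ S)
    (h0 : PeelState r n k s (Finset.range n) 0 σ) :
    Exec (peel r) σ (n * (n * (4 * (blocks r n).length + 8) + 7) + 1) fun σ' =>
      ∃ W w, PeelState r n k s W w σ' ∧ W.card ≤ 2 * k + (r - 1) := by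
  refine (Exec.loop (T := n * (4 * (blocks r n).length + 8) + 6)
    (fun i σ' => ∃ W w, PeelState r n k s W w σ' ∧ W.card + i = n)
    -- Each pass removes one vertex, and the loop runs as long as `|W| ≥ 2k + r`, the range of the
    -- peeling step.
    (n - (2 * k + (r - 1))) ?_ ?_ ⟨_, _, h0, by simp⟩).mono
    (Nat.add_le_add_right (Nat.mul_le_mul_right _ (Nat.sub_le _ _)) 1) ?_
  · rintro τ ⟨W, w, h, hc⟩
    simp only [Expr.eval, h.card_eq, h.loaded.k_eq]
    omega
  · rintro i hi τ ⟨W, w, h, hc⟩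
    refine ⟨by simp only [Expr.eval, h.card_eq, h.loaded.k_eq]; omega, ?_⟩
    refine (Exec.seq (T := n * (4 * (blocks r n).length + 8) + 3) (T' := 3)
      ((exec_argmaxWins h.loaded h.flagged h.peeled.subset).mono le_rfl ?_))
    rintro τ' ⟨g1, g2, g3, g4⟩
    have hs' : ∀ S ∈ W.powersetCard r, s S ∈ S := fun S hS =>
      hs S (Finset.powersetCard_mono h.peeled.subset hS)
    obtain ⟨u, hu, hpos⟩ := exists_wins_pos (by omega) hs'
    have h5 : τ'.var 5 ≠ 0 := by
      have := g3 u (by simpa using h.peeled.subset hu)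
      omega
    have h6 := g4 h5
    have hv : τ'.var 6 ∈ W := by
      obtain ⟨S, hS⟩ := Finset.card_pos.1 (show 0 < wins r s W (τ'.var 6) by omega)
      rw [Finset.mem_filter] at hS
      rw [← hS.2]
      exact (Finset.mem_powersetCard.1 hS.1).1 (hs' S hS.1)
    have hstep := h.peeled.step hr hs (by omega) hv fun x hx => by
      rw [h6]
      exact g3 x (by simpa using h.peeled.subset hx)
    have hcard := Finset.card_erase_of_mem hv
    have hpos' : 0 < W.card := Finset.card_pos.2 ⟨_, hv⟩
    refine Exec.seq (T := 1) (T' := 2) (Exec.write (Exec.seq (T := 1) (T' := 1)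
      (Exec.assign (Exec.assign ⟨_, _, ⟨?_, ?_, hstep, ?_, ?_⟩, by omega⟩))))
    · refine h.loaded.congr ?_ ?_
      · simp only [Store.setVar_arr]
        rw [Store.setArr_arr_of_ne _ _ _ _ (by decide), g1]
      · simp [g2]
    · intro x hx
      simp only [Store.setVar_arr, Store.setArr_arr, true_and, Expr.eval, g1, h.flagged x hx,
        Finset.mem_erase]
      split_ifs <;> tauto
    · simp [Expr.eval, g2, h6, h.wins_eq]
    · simp [Expr.eval, g2, h.card_eq, hcard]
  · rintro τ ⟨W, w, h, hc⟩
    exact ⟨W, w, h, by omega⟩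

/-- The register `x₄` counts the kept vertices seen so far, which is the new name of the next kept
one. -/
theorem exec_rename {w : ℕ} (h : PeelState r n k s W w σ) :
    Exec rename σ (5 * n + 3) fun σ' => PeelState r n k s W w σ' ∧
      ∀ v < n, σ'.arr 2 v = Nat.count (· ∈ W) v := by
  refine (Exec.seq (T := 1) (Exec.assign (Exec.forVar (N := n) (T := 3)
    (fun i σ' => PeelState r n k s W w σ' ∧ σ'.var 4 = Nat.count (· ∈ W) i ∧
      ∀ v < i, σ'.arr 2 v = Nat.count (· ∈ W) v) ?_ ?_ ?_ ?_))).mono (by omega)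
    fun _ h => ⟨h.1, h.2.2⟩
  · rintro i τ m ⟨h1, h2, h3⟩
    exact ⟨⟨h1.loaded.congr rfl (by simp), h1.flagged, h1.peeled, by simp [h1.wins_eq],
      by simp [h1.card_eq]⟩, by simp [h2], h3⟩
  · rintro i τ ⟨h1, -⟩
    exact h1.loaded.n_eq
  · rintro i hi τ ⟨h1, h2, h3⟩ hp
    have hP : PeelState r n k s W w (τ.setArr 2 i (τ.var 4)) :=
      ⟨h1.loaded.congr (Store.setArr_arr_of_ne _ _ _ _ (by decide)) rfl,
        h1.flagged.congr (Store.setArr_arr_of_ne _ _ _ _ (by decide)), h1.peeled, h1.wins_eq,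
        h1.card_eq⟩
    have harr : ∀ v < i + 1, (τ.setArr 2 i (τ.var 4)).arr 2 v = Nat.count (· ∈ W) v := by
      intro v hv
      rw [Store.setArr_arr]
      by_cases hvi : v = i
      · simp [hvi, h2]
      · simp [hvi, h3 v (by omega)]
    have hflag : (τ.setArr 2 i (τ.var 4)).arr 1 i = if i ∈ W then 0 else 1 := hP.flagged i hi
    refine Exec.seq (T := 1) (T' := 2) (Exec.write ?_)
    simp only [Expr.eval, hp]
    refine Exec.cond (T := 1) (fun hc => Exec.skip ⟨⟨hP, ?_, harr⟩, hp⟩)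
      (fun hc => Exec.assign ⟨⟨⟨hP.loaded.congr rfl (by simp), hP.flagged, hP.peeled,
        by simp [h1.wins_eq], by simp [h1.card_eq]⟩, ?_, harr⟩, by simp [hp]⟩)
    · have hiW : i ∉ W := fun hiW => hc (by simp [Expr.eval, hp, hflag, hiW])
      rw [Nat.count_succ, if_neg hiW]
      exact h2
    · have hiW : i ∈ W := by
        by_contra hiW
        simp [Expr.eval, hp, hflag, hiW] at hc
      rw [Nat.count_succ, if_pos hiW]
      simp [Expr.eval, h2]
  · exact ⟨⟨h.loaded.congr rfl (by simp), h.flagged, h.peeled, by simp [h.wins_eq],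
      by simp [h.card_eq]⟩, by simp [Expr.eval], fun v hv => absurd hv (Nat.not_lt_zero v)⟩

theorem exec_countDead {w : ℕ} (h : PeelState r n k s W w σ) :
    Exec (countDead r) σ (4 * (blocks r n).length + 3) fun σ' => PeelState r n k s W w σ' ∧
      σ'.arr 2 = σ.arr 2 ∧ σ'.var 10 = dead r (Finset.range n) W := by
  refine (Exec.seq (T := 1) (Exec.assign (Exec.forBlock (T := 2) (M := (blocks r n).length)
    (fun i σ' => PeelState r n k s W w σ' ∧ σ'.arr 2 = σ.arr 2 ∧
      σ'.var 10 = ((blocks r n).take i).countP fun l => !l.all (· ∈ W))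
    (Nat.succ_pos r) ?_ ?_ ?_ ?_))).mono (by omega) ?_
  · rintro i τ m ⟨h1, h2, h3⟩
    exact ⟨⟨h1.loaded.congr rfl (by simp), h1.flagged, h1.peeled, by simp [h1.wins_eq],
      by simp [h1.card_eq]⟩, h2, by simp [h3]⟩
  · rintro i τ ⟨h1, -⟩
    exact h1.loaded.length_eq
  · rintro i hi τ ⟨h1, h2, h3⟩ hp
    have he := eval_deadExpr h1.loaded h1.flagged hi hp
    refine Exec.cond (T := 1)
      (fun hc => Exec.assign ⟨⟨⟨h1.loaded.congr rfl (by simp), h1.flagged, h1.peeled,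
        by simp [h1.wins_eq], by simp [h1.card_eq]⟩, h2, ?_⟩, by simp [hp]⟩)
      (fun hc => Exec.skip ⟨⟨h1, h2, ?_⟩, hp⟩)
    · rw [countP_take_succ _ _ hi, if_pos]
      · simp [Expr.eval, h3]
      · rw [Bool.not_eq_true', ← Bool.not_eq_true, ← he]
        exact hc
    · rw [countP_take_succ _ _ hi, if_neg, h3, Nat.add_zero]
      rw [Bool.not_eq_true', ← Bool.not_eq_true, ← he, not_not]
      exact hc
  · exact ⟨⟨h.loaded.congr rfl (by simp), h.flagged, h.peeled, by simp [h.wins_eq],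
      by simp [h.card_eq]⟩, rfl, by simp [Expr.eval]⟩
  · rintro τ ⟨h1, h2, h3⟩
    rw [List.take_length] at h3
    exact ⟨h1, h2, h3.trans (dead_eq_countP W).symm⟩

theorem ignoresOutput_blockExprs (r : ℕ) : ∀ e ∈ blockExprs r, IgnoresOutput e := by
  intro e he σ σ' h
  simp only [blockExprs, List.mem_append, List.mem_map, List.mem_singleton] at he
  rcases he with ⟨j, -, rfl⟩ | rfl <;>
    simp [Expr.eval, selExpr, h.1 2 (by decide), h.1 3 (by decide), h.2 2 (by decide)]

theorem map_eval_blockExprs (hl : Loaded r n k s σ)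
    (hs : ∀ S ∈ (Finset.range n).powersetCard r, s S ∈ S)
    (hc : ∀ v < n, σ.arr 2 v = Nat.count (· ∈ W) v) {i : ℕ}
    (hi : i < (blocks r n).length) (h2 : σ.var 2 = 2 + (r + 1) * i) :
    (blockExprs r).map (Expr.eval σ) =
      (blocks r n)[i].map (Nat.count (· ∈ W)) ++
        [Nat.count (· ∈ W) (s (blocks r n)[i].toFinset)] := by
  have hmem : (blocks r n)[i] ∈ blocks r n := List.getElem_mem hi
  have hS := toFinset_mem_powersetCard hmem
  have hsel := (Finset.mem_powersetCard.1 hS).1 (hs _ hS)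
  rw [blockExprs, List.map_append, List.map_singleton, List.map_map]
  congr 1
  · rw [← hl.block_eq i hi, List.map_map]
    refine List.map_congr_left fun j hj => ?_
    simp only [Function.comp, Expr.eval, h2]
    refine hc _ ?_
    have : σ.arr 3 (2 + (r + 1) * i + j) ∈ (blocks r n)[i] := by
      rw [← hl.block_eq i hi]
      exact List.mem_map_of_mem hj
    simpa using (List.mem_sublistsLen.1 hmem).1.subset this
  · rw [Expr.eval, eval_selExpr hl hi h2, hc _ (by simpa using hsel)]

theorem exec_outputRestriction {w : ℕ} (h : PeelState r n k s W w σ)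
    (hs : ∀ S ∈ (Finset.range n).powersetCard r, s S ∈ S)
    (hc : ∀ v < n, σ.arr 2 v = Nat.count (· ∈ W) v) (hout : σ.output = []) :
    Exec (outputRestriction r) σ ((2 * r + 6) * (blocks r n).length + 7) fun σ' =>
      σ'.output = encodeSel r W.card (k + w - σ.var 10) (restrictSel s W) := by
  refine Exec.mono (Exec.seq (T := 5) (T' := (blocks r n).length * (2 * r + 4 + 2) + 2)
    ((Exec.pushAll ?_).mono le_rfl ?_)) (by ring_nf; omega) fun _ h => h
  · intro e he τ τ' h
    simp only [List.mem_cons, List.not_mem_nil, or_false] at he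
    rcases he with rfl | rfl
    · simp [Expr.eval, h.2 8 (by decide)]
    · simp [Expr.eval, h.1 3 (by decide), h.2 7 (by decide), h.2 10 (by decide)]
  rintro τ ⟨h1, h2⟩
  rw [hout, List.nil_append] at h1
  refine (Exec.forBlock (T := 2 * r + 4) (M := (blocks r n).length)
    (fun i σ' => PeelState r n k s W w σ' ∧ σ'.arr 2 = σ.arr 2 ∧ σ'.output =
      W.card :: (k + w - σ.var 10) ::
        (((blocks r n).take i).filter fun l => l.all (· ∈ W)).flatMap fun l =>
          l.map (Nat.count (· ∈ W)) ++ [Nat.count (· ∈ W) (s l.toFinset)])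
    (Nat.succ_pos r) ?_ ?_ ?_ ?_).mono le_rfl ?_
  · rintro i τ m ⟨h1, h2, h3⟩
    refine ⟨⟨h1.loaded.congr rfl (by simp), h1.flagged, h1.peeled, by simp [h1.wins_eq],
      by simp [h1.card_eq]⟩, h2, ?_⟩
    rw [← h3]
    simp [Store.output]
  · rintro i τ ⟨h1, -⟩
    exact h1.loaded.length_eq
  · rintro i hi τ ⟨h1, h2, h3⟩ hp
    have he := eval_deadExpr h1.loaded h1.flagged hi hp
    rw [← List.take_concat_get' _ i hi, List.filter_append, List.flatMap_append]
    refine Exec.cond (T := 2 * r + 3)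
      (fun hd => (Exec.skip ⟨⟨h1, h2, ?_⟩, hp⟩).mono (by omega) fun _ h => h)
      (fun hd => (Exec.pushAll (ignoresOutput_blockExprs r)).mono
        (by simp [blockExprs]; omega) ?_)
    · rintro τ' ⟨g1, g2⟩
      refine ⟨⟨⟨h1.loaded.congr (g2.1 3 (by decide)) (g2.2 1 (by decide)),
        h1.flagged.congr (g2.1 1 (by decide)), h1.peeled, by rw [g2.2 7 (by decide), h1.wins_eq],
        by rw [g2.2 8 (by decide), h1.card_eq]⟩, (g2.1 2 (by decide)).trans h2, ?_⟩,
        by rw [g2.2 2 (by decide), hp]⟩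
      rw [he] at hd
      rw [g1, h3, map_eval_blockExprs h1.loaded hs (by rw [h2]; exact hc) hi hp,
        List.filter_cons_of_pos (p := fun l : List ℕ => l.all (· ∈ W)) hd]
      simp
    · rw [ne_eq, he] at hd
      rw [h3, List.filter_cons_of_neg (p := fun l : List ℕ => l.all (· ∈ W)) hd]
      simp
  · refine ⟨⟨h.loaded.congr (h2.1 3 (by decide)) (h2.2 1 (by decide)),
        h.flagged.congr (h2.1 1 (by decide)), h.peeled, by rw [h2.2 7 (by decide), h.wins_eq],
        by rw [h2.2 8 (by decide), h.card_eq]⟩, h2.1 2 (by decide), ?_⟩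
    rw [h1]
    simp [Expr.eval, h.card_eq, h.wins_eq, h.loaded.k_eq]
  · rintro τ ⟨-, -, h3⟩
    rw [h3, List.take_length, encodeSel_restrictSel h.peeled.subset]

end DenseFAS

/-! ### Input layout, running time and conclusion -/

namespace DenseFAS

open RAM

variable {r n k : ℕ} {s : Finset ℕ → ℕ}

theorem getD_flatMap_of_length {α : Type*} (f : α → List ℕ) {d : ℕ} (B : List α)
    (hd : ∀ b ∈ B, (f b).length = d) {i j : ℕ} (hi : i < B.length) (hj : j < d) :
    (B.flatMap f).getD (d * i + j) 0 = (f B[i]).getD j 0 := by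
  induction B generalizing i with
  | nil => simp at hi
  | cons b B ih =>
    have hb := hd b List.mem_cons_self
    rw [List.flatMap_cons]
    cases i with
    | zero =>
      rw [Nat.mul_zero, Nat.zero_add, List.getD_append _ _ _ _ (by omega)]
      rfl
    | succ i =>
      rw [List.getD_append_right _ _ _ _ (by rw [hb, Nat.mul_succ]; omega)]
      rw [show d * (i + 1) + j - (f b).length = d * i + j by rw [hb, Nat.mul_succ]; omega]
      exact ih (fun c hc => hd c (List.mem_cons_of_mem _ hc)) (by simpa using hi)

theorem length_of_mem_blocks {l : List ℕ} (h : l ∈ blocks r n) : l.length = r :=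
  (List.mem_sublistsLen.1 h).2

theorem length_encodeSel : (encodeSel r n k s).length = 2 + (r + 1) * (blocks r n).length := by
  have : ∀ l ∈ blocks r n, (l ++ [s l.toFinset]).length = r + 1 := fun l hl => by
    simp [length_of_mem_blocks hl]
  rw [encodeSel, List.length_cons, List.length_cons, List.length_flatMap, List.map_congr_left this,
    List.map_const', List.sum_replicate, smul_eq_mul]
  ring

theorem getD_encodeSel {i j : ℕ} (hi : i < (blocks r n).length) (hj : j < r + 1) :
    (encodeSel r n k s).getD (2 + (r + 1) * i + j) 0 =
      ((blocks r n)[i] ++ [s (blocks r n)[i].toFinset]).getD j 0 := by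
  rw [← getD_flatMap_of_length (fun l => l ++ [s l.toFinset]) (blocks r n)
    (fun l hl => by simp [length_of_mem_blocks hl]) hi hj, encodeSel,
    show 2 + (r + 1) * i + j = ((r + 1) * i + j) + 1 + 1 by ring, List.getD_cons_succ,
    List.getD_cons_succ]

theorem loaded_of_getD {σ : Store} (h1 : σ.var 1 = (encodeSel r n k s).length)
    (h3 : ∀ i < (encodeSel r n k s).length, σ.arr 3 i = (encodeSel r n k s).getD i 0) :
    Loaded r n k s σ := by
  have hlen := length_encodeSel (r := r) (n := n) (k := k) (s := s)
  have hlt : ∀ i < (blocks r n).length, ∀ j < r + 1,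
      2 + (r + 1) * i + j < (encodeSel r n k s).length := by
    intro i hi j hj
    have := Nat.mul_le_mul_left (r + 1) (Nat.succ_le_of_lt hi)
    rw [Nat.mul_succ] at this
    omega
  refine ⟨?_, ?_, h1.trans hlen, fun i hi => ?_, fun i hi => ?_⟩
  · rw [h3 0 (by omega), encodeSel, List.getD_cons_zero]
  · rw [h3 1 (by omega), encodeSel, List.getD_cons_succ, List.getD_cons_zero]
  · have hl : (blocks r n)[i].length = r := length_of_mem_blocks (List.getElem_mem hi)
    refine List.ext_getElem (by simp [hl]) fun j hj hj' => ?_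
    rw [List.getElem_map, List.getElem_range, h3 _ (hlt i hi j (by omega)),
      getD_encodeSel hi (by omega), List.getD_append _ _ _ _ hj', List.getD_eq_getElem _ _ hj']
  · have hl : (blocks r n)[i].length = r := length_of_mem_blocks (List.getElem_mem hi)
    rw [h3 _ (hlt i hi r (by omega)), getD_encodeSel hi (by omega),
      List.getD_append_right _ _ _ _ hl.le, hl]
    simp

/-- The input is moved away because the output will overwrite `A₀`. The initial zeros of `A₁` and
`x₇` already say that nothing has been removed. -/
theorem exec_load (l : List ℕ) (hl : l = encodeSel r n k s) :
    Exec load (Store.input l) (3 * l.length + 4) fun σ =>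
      PeelState r n k s (Finset.range n) 0 σ := by
  refine (Exec.seq (T := 1) (T' := l.length * (1 + 2) + 2 + 1) (Exec.assign (Exec.seq
    ((Exec.forVar (N := l.length) (T := 1) (fun i σ => (∀ a, a ≠ 3 → σ.arr a = (Store.input l).arr a) ∧
      (∀ j < i, σ.arr 3 j = l.getD j 0) ∧ σ.var 1 = l.length ∧ σ.var 7 = 0)
      ?_ ?_ ?_ ?_).mono le_rfl ?_)))).mono (by omega) fun _ h => h
  · rintro i σ m ⟨h1, h2, h3, h4⟩
    exact ⟨h1, h2, by simp [h3], by simp [h4]⟩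
  · rintro i σ ⟨h1, h2, h3, h4⟩
    exact h3
  · rintro i hi σ ⟨h1, h2, h3, h4⟩ hp
    refine Exec.write ⟨⟨fun a ha => ?_, fun j hj => ?_, h3, h4⟩, hp⟩
    · rw [Store.setArr_arr_of_ne _ _ _ _ ha, h1 a ha]
    · rw [Store.setArr_arr]
      by_cases hji : j = i
      · simp [Expr.eval, hji, hp, h1, Store.input]
      · simp only [Expr.eval, hp, hji, and_false, if_false]
        exact h2 j (by omega)
  · exact ⟨fun a _ => rfl, fun j hj => absurd hj (Nat.not_lt_zero j),
      by simp [Expr.eval, Store.input], by simp [Store.input]⟩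
  · rintro σ ⟨h1, h2, h3, h4⟩
    subst hl
    have hload := loaded_of_getD h3 h2
    refine Exec.assign ⟨hload.congr rfl (by simp), ?_, Peeled.refl k, by simp [h4],
      by simp [Expr.eval, hload.n_eq]⟩
    intro v hv
    rw [Store.setVar_arr, h1 1 (by decide)]
    simp [Store.input, hv]

/-- A bound for the number of steps, in terms of the numbers of vertices, blocks, input entries, and
the length of the fixed `No`-instance. -/
def stepBound (r n M L o : ℕ) : ℕ :=
  (3 * L + 4) + ((n * (n * (4 * M + 8) + 7) + 1) + ((5 * n + 3) + ((4 * M + 3) +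
    (1 + ((2 * o + 1) + ((2 * r + 6) * M + 7) + 1)))))

theorem exec_kernelize (hr : 3 ≤ r) (R N : Instance r) (hN : ¬ N.IsYes) :
    Exec (kernelize r N.encode) (Store.input R.encode)
      (stepBound r R.n (blocks r R.n).length R.encode.length N.encode.length) fun σ =>
      ∃ R' : Instance r, σ.output = R'.encode ∧ (R'.IsYes ↔ R.IsYes) ∧
        ((R'.n = N.n ∧ R'.k = N.k) ∨ (R'.n ≤ 2 * R.k + (r - 1) ∧ R'.k ≤ R.k)) := by
  have hs : ∀ S ∈ (Finset.range R.n).powersetCard r, R.selNat S ∈ S := fun S hS => R.selNat_mem hS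
  refine Exec.seq ((exec_load _ R.encode_eq).mono le_rfl fun σ₁ h1 => ?_)
  refine Exec.seq ((exec_peel hr hs h1).mono le_rfl ?_)
  rintro σ₂ ⟨W, w, h2, hW⟩
  refine Exec.seq ((exec_rename h2).mono le_rfl ?_)
  rintro σ₃ ⟨h3, hc⟩
  refine Exec.seq ((exec_countDead h3).mono le_rfl ?_)
  rintro σ₄ ⟨h4, h4', h10⟩
  have hyes := h4.peeled.yes_iff
  rw [← R.isYes_iff] at hyes
  have hP : PeelState r R.n R.k R.selNat W w (σ₄.setVar 0 0) :=
    ⟨h4.loaded.congr rfl (by simp), h4.flagged, h4.peeled, by simp [h4.wins_eq],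
      by simp [h4.card_eq]⟩
  refine Exec.seq (Exec.assign (Exec.cond (fun hd => ?_) fun hd => ?_))
  · refine (Exec.pushAll ?_).mono ?_ ?_
    · intro e he
      obtain ⟨m, -, rfl⟩ := List.mem_map.1 he
      exact fun _ _ _ => rfl
    · rw [List.length_map]
      omega
    · rintro σ₅ ⟨h5, -⟩
      refine ⟨N, ?_, ?_, Or.inl ⟨rfl, rfl⟩⟩
      · rw [h5, List.map_map]
        simp [Store.output, Expr.eval, Function.comp_def]
      -- In this branch the losses already paid exceed `k`, so the input is a No-instance too.
      · refine iff_of_false hN fun h => hd ?_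
        have := (hyes.1 h).1
        simp [Expr.eval, h4.wins_eq, h10, h4.loaded.k_eq]
        omega
  · refine (exec_outputRestriction hP hs (fun v hv => ?_) (by simp [Store.output])).mono
      (by omega) fun σ₅ h5 => ?_
    · change σ₄.arr 2 v = _
      rw [h4', hc v hv]
    -- The losses fit into the budget, so the truncated subtraction in the new parameter is exact.
    · have hd' : dead r (Finset.range R.n) W ≤ R.k + w := by
        simp [Expr.eval, h4.wins_eq, h10, h4.loaded.k_eq] at hd
        omega
      have hsW : ∀ S ∈ W.powersetCard r, R.selNat S ∈ S := fun S hS =>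
        hs S (Finset.powersetCard_mono h4.peeled.subset hS)
      have hle := h4.peeled.le_dead
      refine ⟨Instance.ofSel W.card (R.k + w - dead r (Finset.range R.n) W)
        (restrictSel R.selNat W) (restrictSel_mem hsW), ?_, ?_, Or.inr ⟨hW, ?_⟩⟩
      · rw [h5, Instance.encode_ofSel]
        simp [h10]
      · rw [Instance.isYes_ofSel, hyes, and_iff_right hd']
        exact yesOn_renumber (image_nth_range W).symm (fun i hi => count_nth_of_lt_card hi) hsW _
      · change R.k + w - dead r (Finset.range R.n) W ≤ R.k
        omega

theorem length_le_bitLength (l : List ℕ) : l.length ≤ bitLength l := by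
  induction l with
  | nil => simp
  | cons m l ih =>
    simp only [bitLength, List.map_cons, List.sum_cons, List.length_cons] at ih ⊢
    omega

theorem length_blocks_le (R : Instance r) :
    (blocks r R.n).length ≤ bitLength R.encode := by
  refine le_trans ?_ (length_le_bitLength _)
  rw [R.encode_eq, length_encodeSel]
  nlinarith [Nat.zero_le (r * (blocks r R.n).length)]

/-- The number `n` itself is written in binary and gives no linear bound. For `n ≥ r` the at least
`n - r + 1` blocks do; smaller `n` are covered by the summand `r`. -/
theorem card_vertices_le (hr : 1 ≤ r) (R : Instance r) : R.n ≤ bitLength R.encode + r := by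
  by_cases h : R.n < r
  · omega
  · have h1 := length_blocks_le R
    have h2 := sub_add_one_le_choose hr (not_lt.1 h)
    rw [blocks, List.length_sublistsLen, List.length_range] at h1
    omega

theorem stepBound_mono {n n' M M' L L' : ℕ} (r o : ℕ) (hn : n ≤ n') (hM : M ≤ M') (hL : L ≤ L') :
    stepBound r n M L o ≤ stepBound r n' M' L' o := by
  unfold stepBound
  gcongr

theorem exists_polynomial_stepBound (r o : ℕ) :
    ∃ P : Polynomial ℕ, ∀ x, P.eval x = stepBound r (x + r) x x o := by
  refine ⟨(3 * .X + 4) + (((.X + .C r) * ((.X + .C r) * (4 * .X + 8) + 7) + 1) +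
    ((5 * (.X + .C r) + 3) + ((4 * .X + 3) +
      (1 + ((2 * .C o + 1) + ((2 * .C r + 6) * .X + 7) + 1))))), fun x => ?_⟩
  simp [stepBound]

/-- Dense feedback arc set with constraints of arity `r ≥ 3` has a kernel with at most
`2 * k + r - 1` vertices, apart from a fixed `No`-instance. -/
theorem vertexKernel_two_mul (hr : 3 ≤ r) :
    AdmitsVertexKernel r fun k => max (r + 1) (2 * k + (r - 1)) := by
  set N := Instance.conflict hr
  have h := fun R => exec_kernelize hr R N (Instance.not_isYes_conflict hr)
  -- The kernel map is obtained by choice, but one fixed program outputs the encodings of its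
  -- values, which is all that computability asks.
  choose σ t hrun ht R' hout hyes hsize using h
  obtain ⟨P, hP⟩ := exists_polynomial_stepBound r N.encode.length
  refine ⟨R', ⟨_, P, fun R => ⟨σ R, t R, hrun R, (ht R).trans ?_, hout R⟩⟩, fun R => ⟨hyes R, ?_⟩⟩
  · rw [hP]
    exact stepBound_mono _ _ (card_vertices_le (by omega) R) (length_blocks_le R)
      (length_le_bitLength _)
  · have hNn : N.n = r + 1 := rfl
    have hNk : N.k = 0 := rfl
    rcases hsize R with h | h
    · exact ⟨le_max_of_le_left (by omega), by omega⟩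
    · exact ⟨le_max_of_le_right h.1, h.2⟩

end DenseFAS

theorem mainTheorem3 (r : ℕ) (hr : 3 ≤ r) :
    DenseFAS.AdmitsVertexKernel r (fun k => if k = 0 then r + 1 else 6 * k + r) := by
  obtain ⟨f, hf, h⟩ := DenseFAS.vertexKernel_two_mul hr
  refine ⟨f, hf, fun R => ⟨(h R).1, (h R).2.1.trans ?_, (h R).2.2⟩⟩
  dsimp only
  -- For `k = 0` the maximum is `r + 1`; for `k ≥ 1` both of its terms are at most `6k + r`.
  split_ifs <;> omega
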